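/- **Setting.** Let $k$ be a field of characteristic zero and let $(W,S)$ be a Coxeter system of type $B_n$ $(n\ge 0)$, with $S=\{1,2,\dots,n\}$ numbered along the Coxeter diagram so that the bond of order $4$ joins $1$ and $2$. For $K\subseteq S$ let $W_K=\langle K\rangle$ and let $w_K$ be its longest element. *Chains.* A chain is a tuple $a=(J_0,J_1,\dots,J_l)$ of subsets of $S$ with $J_0\supseteq J_1\supseteq\cdots\supseteq J_l$ and $|J_i\setminus J_{i+1}|=1$. A generator $s\in S$ acts by $a.s=(J_0^\omega,\dots,J_l^\omega)$, where $\omega=w_{J_0}w_{J_0\cup\{s\}}$ and $J^\omega=\omega^{-1}J\omega$. On linear combinations of chains let $\delta$ be the linear operator with $\delta(a)=a$ if $l=0$, and $\delta(a)=b-b.s$ if $l>0$, where $b=(J_1,\dots,J_l)$ and $J_0\setminus J_1=\{s\}$. Put $\Delta(a)=\delta^l(a)$, a linear combination of subsets of $S$. *Forests.* A tree is a positive integer (a leaf) or a node with a left and a right child, which are trees. The node of $U$ in position $w$ is $U_w$, where $w$ is a word in $1$ (left) and $2$ (right) and $U_\emptyset=U$; $\ell(U)$ is the number of nodes of $U$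 that are not leaves. A forest is a sequence of trees; its value is the sum of its leaves, its foliage is the sequence of its leaves, and its squash is the sequence of the sums of the leaves of its trees. A labeled forest has its (non-leaf) nodes labeled bijectively by $1,\dots,l$, $l$ being the number of nodes, so that labels increase from parent to child. $L_{n+1}$ is the set of labeled forests of value $n+1$. If the foliage of $X$ is the squash of $Y$, then $X\bullet Y$ is obtained from $X$ by replacing its leaves by the trees of $Y$, in order, with the labels of $Y$ raised by the number of nodes of $X$. The mirror image $\overleftarrow U$ is $U$ with the two children of every node exchanged (labels staying at their nodes), and $\overleftrightarrow U=U-\overleftarrow U$. Linear combinations of forests are multiplied by juxtaposition. On unlabeled forests $\pi$ is the linear map to linear combinations of words in the positive integers given by $\pi(x)=x$ for a leaf $x$, $\pi(U)=\pi(U_1)\pi(U_2)-\pi(U_2)\pi(U_1)$ for a node, and $\pi(X_1\cdots X_j)=\pi(X_1)\cdots\pi(X_j)$; node labels are erased before $\pi$ is applied. *The map $\varphi$.* If $S\setminus J=\{t_1<\dots<t_{j-1}\}$, $t_0=0$, $t_j=n+1$, then $\varphi(J)$ is the composition (word) $q_1\cdots q_j$ of $n+1$ with $q_i=t_i-t_{i-1}$.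 For a chain, $\varphi(J_0,\dots,J_l)=X_1\bullet\cdots\bullet X_l$, where $X_i$ is the unique labeled forest with exactly one node, squash $\varphi(J_{i-1})$ and foliage $\varphi(J_i)$; for $l=0$ it is the forest of leaves $\varphi(J_0)$. We extend $\varphi$ linearly. **Proposition.** Let $X=UV_1\cdots V_j\in L_{n+1}$, where $U,V_1,\dots,V_j$ are trees, and let $a=(J_0,\dots,J_l)$ be a chain with $\varphi(a)=X$. Write $S\setminus J_0=\{t_0<t_1<\cdots<t_{j-1}\}$, and write $X.s=\varphi(a.s)$, $\delta(X)=\varphi(\delta(a))$, $\Delta(X)=\varphi(\Delta(a))$. For every $s\in S$ the sets making up $a.s$ are again subsets of $S$ and $a.s$ is again a chain. Moreover: 1. If $j\ge 1$, then $X.t_0=U\overleftarrow{V_1}V_2\cdots V_j$. For $1\le i\le j-1$, $X.t_i=UV_1\cdots V_{i+1}V_i\cdots V_j$, that is, $V_i$ and $V_{i+1}$ are exchanged. 2. If $l\ge1$, then $\delta(X)$ is obtained, by subtracting $1$ from all the node labels, from $$U_1\overleftrightarrow{U_2}V_1\cdots V_j\quad\text{if $U$ is the node of $X$ labeled $1$,}$$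 $$UV_1\cdots V_{i-1}\left(V_{i1}V_{i2}-V_{i2}V_{i1}\right)V_{i+1}\cdots V_j\quad\text{if $V_i$ is the node of $X$ labeled $1$,}$$ where $V_{i1},V_{i2}$ are the left and right child of $V_i$. 3. Let $m$ be the greatest integer for which the position $1^m$ exists in $U$. Then $$\Delta(X)=\pi\left(U_{1^m}\,\overleftrightarrow{U_{1^{m-1}2}}\;\overleftrightarrow{U_{1^{m-2}2}}\cdots\overleftrightarrow{U_2}\;V_1\cdots V_j\right)$$ $$=\begin{cases}2^m\,\pi\left(U_{1^m}U_{1^{m-1}2}\cdots U_2V_1\cdots V_j\right)&\text{if }\ell(U_{1^i2})\text{ is odd for all }0\le i\le m-1,\\ 0&\text{otherwise.}\end{cases}$$ -/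

import Mathlib

namespace DescentB

/-! ### Trees and forests -/

/-- Binary trees whose leaves are natural numbers and whose inner nodes carry a label in `α`:
`α = ℕ` for labeled trees, `α = Unit` for unlabeled trees. A forest is a list of trees. -/
inductive LeafTree (α : Type) : Type
  | leaf (x : ℕ) : LeafTree α
  | node (a : α) (l r : LeafTree α) : LeafTree α

namespace LeafTree

variable {α β : Type}

/-- The number of (inner) nodes, `ℓ(U)`. -/
def length : LeafTree α → ℕ
  | leaf _ => 0
  | node _ l r => l.length + r.length + 1

/-- The leaves of a tree, from left to right. -/
def foliage : LeafTree α → List ℕ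
  | leaf x => [x]
  | node _ l r => l.foliage ++ r.foliage

/-- The sum of the leaves of a tree. -/
def value : LeafTree α → ℕ
  | leaf x => x
  | node _ l r => l.value + r.value

/-- The node labels of a tree. -/
def labels : LeafTree α → List α
  | leaf _ => []
  | node a l r => a :: (l.labels ++ r.labels)

/-- Apply a function to all the node labels. -/
def map (f : α → β) : LeafTree α → LeafTree β
  | leaf x => leaf x
  | node a l r => node (f a) (l.map f) (r.map f)

/-- Erase the node labels. -/
def erase (U : LeafTree α) : LeafTree Unit := U.map (fun _ => ())

/-- The mirror image of a tree (every label stays at its node). -/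
def mirror : LeafTree α → LeafTree α
  | leaf x => leaf x
  | node a l r => node a r.mirror l.mirror

/-- The node in position `w`, a word in the letters `1` (left child) and `2` (right child);
`none` if there is no such position. -/
def subtree? : LeafTree α → List ℕ → Option (LeafTree α)
  | U, [] => some U
  | leaf _, _ :: _ => none
  | node _ l r, i :: w => if i = 1 then l.subtree? w else if i = 2 then r.subtree? w else none

/-- The node `U_w` in position `w`, used only at positions that exist. -/
def subtree (U : LeafTree α) (w : List ℕ) : LeafTree α := (U.subtree? w).getD (leaf 0)

/-- Every child of a node with label `a` has a label greater than `a`, where the root itself is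
required to have a label greater than `p`. -/
def IncreasingAbove (p : ℕ) : LeafTree ℕ → Prop
  | leaf _ => True
  | node a l r => p < a ∧ l.IncreasingAbove a ∧ r.IncreasingAbove a

/-- The label of every node is greater than the label of its parent, if it has one. -/
def Increasing : LeafTree ℕ → Prop
  | leaf _ => True
  | node a l r => l.IncreasingAbove a ∧ r.IncreasingAbove a

/-- Replace the leaves of a tree, from left to right, by the trees of a list of the same length. -/
def graft : LeafTree α → List (LeafTree α) → LeafTree α
  | leaf x, Y => Y.headD (leaf x)
  | node a l r, Y =>
      node a (l.graft (Y.take l.foliage.length)) (r.graft (Y.drop l.foliage.length))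

end LeafTree

open LeafTree

/-- The foliage of a forest: the sequence of its leaves. -/
def forestFoliage {α : Type} (X : List (LeafTree α)) : List ℕ := X.flatMap foliage

/-- The squash of a forest: the sequence of the values of its trees. -/
def forestSquash {α : Type} (X : List (LeafTree α)) : List ℕ := X.map value

/-- The node labels of a forest. -/
def forestLabels {α : Type} (X : List (LeafTree α)) : List α := X.flatMap labels

/-- The length of a forest: the number of its nodes. -/
def forestLength {α : Type} (X : List (LeafTree α)) : ℕ := (X.map length).sum

/-- Labeled forests of value `N`: the leaves are positive with sum `N`, labels increase from
parent to child, and each of `1, …, l` labels exactly one node, `l` being the number of nodes. -/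
structure IsLabeledForest (N : ℕ) (X : List (LeafTree ℕ)) : Prop where
  leaves_pos : ∀ x ∈ forestFoliage X, 0 < x
  value_eq : (forestSquash X).sum = N
  increasing : ∀ U ∈ X, U.Increasing
  labels_perm : (forestLabels X).Perm (List.range' 1 (forestLength X))

/-- Replace the leaves of a forest, from left to right, by the trees of a second forest. -/
def forestGraft {α : Type} : List (LeafTree α) → List (LeafTree α) → List (LeafTree α)
  | [], _ => []
  | T :: X, Y => T.graft (Y.take T.foliage.length) :: forestGraft X (Y.drop T.foliage.length)

/-- The product `X • Y` of labeled forests, used only when the foliage of `X` is the squash of `Y`: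
the leaves of `X` are replaced by the trees of `Y`, whose labels are raised by the length of `X`. -/
def forestMul (X Y : List (LeafTree ℕ)) : List (LeafTree ℕ) :=
  forestGraft X (Y.map (LeafTree.map (· + forestLength X)))

/-! ### Subsets, compositions, and the map `φ` -/

/-- The composition `q₁ q₂ ⋯ q_j` of `n + 1` attached to a subset `J` of the generators
`{1, …, n}` (the element `i : Fin n` is the generator `i + 1`): if `t₁ < ⋯ < t_{j-1}` are the
elements of the complement, `t₀ = 0` and `t_j = n + 1`, then `q_i = t_i - t_{i-1}`. -/
def composition {n : ℕ} (J : Finset (Fin n)) : List ℕ :=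
  let t : List ℕ := (Jᶜ.image (fun i : Fin n => (i : ℕ) + 1)).sort (· ≤ ·)
  List.zipWith (fun x y => y - x) (0 :: t) (t ++ [n + 1])

/-- If the composition `d` arises from `c` by splitting one part `x = y + z` into `y, z`, this is
the labeled forest of length one with squash `c` and foliage `d`
(see `splitForest_unique`). -/
def splitForest : List ℕ → List ℕ → List (LeafTree ℕ)
  | x :: c, y :: d =>
      if x = y then leaf x :: splitForest c d
      else match d with
        | z :: _ => node 1 (leaf y) (leaf z) :: c.map leaf
        | [] => []
  | _, _ => []

lemma eq_leaves_of_labels_nil (X : List (LeafTree ℕ)) (h : forestLabels X = []) :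
    X = (forestSquash X).map leaf := by
  induction X with
  | nil => rfl
  | cons T X ih =>
    simp only [forestLabels, List.flatMap_cons, List.append_eq_nil_iff] at h
    cases T with
    | leaf x => simpa [forestSquash, value] using ih h.2
    | node a l r => simp [labels] at h

/-- `splitForest c d` is the unique forest of length one, with label `1` and positive leaves, that
has squash `c` and foliage `d`, whenever there is such a forest. -/
theorem splitForest_unique (X : List (LeafTree ℕ)) (hl : forestLabels X = [1])
    (hp : ∀ x ∈ forestFoliage X, 0 < x) :
    splitForest (forestSquash X) (forestFoliage X) = X := by
  induction X with
  | nil => simp [forestLabels] at hl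
  | cons T X ih =>
    cases T with
    | leaf x =>
      have h1 : forestLabels X = [1] := by simpa [forestLabels, labels] using hl
      have h2 : ∀ y ∈ forestFoliage X, 0 < y := fun y hy =>
        hp y (by simp only [forestFoliage, List.flatMap_cons, List.mem_append]; exact Or.inr hy)
      have := ih h1 h2
      simp only [forestSquash, forestFoliage] at this
      simp [forestSquash, forestFoliage, value, foliage, splitForest, this]
    | node a l r =>
      simp only [forestLabels, List.flatMap_cons, labels, List.cons_append, List.cons.injEq,
        List.append_eq_nil_iff] at hl
      obtain ⟨rfl, ⟨h1, h2⟩, h3⟩ := hl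
      have hX := eq_leaves_of_labels_nil X h3
      cases l with
      | node _ _ _ => simp [labels] at h1
      | leaf y =>
        cases r with
        | node _ _ _ => simp [labels] at h2
        | leaf z =>
          have hz : 0 < z := hp z (by simp [forestFoliage, foliage])
          have hz' : z ≠ 0 := by omega
          simp only [forestSquash] at hX
          simp [forestSquash, forestFoliage, value, foliage, splitForest, hz', ← hX]

/-- Chains `(J₀, J₁, …, J_l)` of subsets of the generating set, `J₀ ⊇ J₁ ⊇ ⋯ ⊇ J_l` with
`|J_i \ J_{i+1}| = 1`. -/
def IsSubsetChain {n : ℕ} (a : List (Finset (Fin n))) : Prop :=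
  a ≠ [] ∧ a.IsChain (fun J K => K ⊆ J ∧ (J \ K).card = 1)

/-- The map `φ` from chains of subsets to labeled forests: `φ(J₀, …, J_l) = X₁ • ⋯ • X_l` where
`X_i` is the labeled forest of length one with squash `φ(J_{i-1})` and foliage `φ(J_i)`. For
`l = 0` the product is the forest of length zero with foliage `φ(J₀)`. -/
def chainForest {n : ℕ} : List (Finset (Fin n)) → List (LeafTree ℕ)
  | [] => []
  | [J] => (composition J).map leaf
  | J :: K :: a => forestMul (splitForest (composition J) (composition K)) (chainForest (K :: a))

/-! ### The action of the generators on chains -/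

/-- The Coxeter matrix of type `B_n` with the generators numbered so that the bond of order `4`
joins the first two generators. -/
def typeB (n : ℕ) : CoxeterMatrix (Fin n) := (CoxeterMatrix.B n).reindex Fin.revPerm

section Action

variable {n : ℕ} {M : CoxeterMatrix (Fin n)} {W : Type*} [Group W] (cs : CoxeterSystem M W)

/-- The parabolic subgroup `W_K`. -/
def parabolic (K : Finset (Fin n)) : Subgroup W := Subgroup.closure (cs.simple '' (K : Set (Fin n)))

/-- `w` is an element of maximal length of `W_K`. -/
def IsLongest (K : Finset (Fin n)) (w : W) : Prop :=
  w ∈ parabolic cs K ∧ ∀ u ∈ parabolic cs K, cs.length u ≤ cs.length w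

/-- The longest element `w_K` of `W_K` (it exists, and is unique, when `W` is finite). -/
noncomputable def longest (K : Finset (Fin n)) : W := Classical.epsilon (IsLongest cs K)

/-- The element `ω = w_J w_{J ∪ {s}}`. -/
noncomputable def omega (J : Finset (Fin n)) (s : Fin n) : W :=
  longest cs J * longest cs (insert s J)

open Classical in
/-- The set of generators lying in the conjugate `J^w = w⁻¹ J w`. -/
noncomputable def conjSubset (w : W) (J : Finset (Fin n)) : Finset (Fin n) :=
  Finset.univ.filter (fun t => ∃ s ∈ J, cs.simple t = w⁻¹ * cs.simple s * w)

/-- The action `(J₀, …, J_l).s = (J₀^ω, …, J_l^ω)` where `ω = w_{J₀} w_{J₀ ∪ {s}}`. -/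
noncomputable def chainAct (a : List (Finset (Fin n))) (s : Fin n) : List (Finset (Fin n)) :=
  match a with
  | [] => []
  | J :: b => (J :: b).map (conjSubset cs (omega cs J s))

variable (k : Type*) [Field k]

/-- The operator `δ` on a single chain: `δ(a) = a` if `l = 0`, and `δ(a) = b - b.s` if `l > 0`,
where `b = (J₁, …, J_l)` and `s` is the element of the one-element set `J₀ \ J₁`
(the sum below has this one term). -/
noncomputable def deltaChain : List (Finset (Fin n)) → (List (Finset (Fin n)) →₀ k)
  | [] => 0
  | [J] => Finsupp.single [J] 1
  | J :: K :: a =>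
      ∑ s ∈ J \ K, (Finsupp.single (K :: a) 1 - Finsupp.single (chainAct cs (K :: a) s) 1)

/-- The linear operator `δ` on linear combinations of chains. -/
noncomputable def delta : (List (Finset (Fin n)) →₀ k) →ₗ[k] (List (Finset (Fin n)) →₀ k) :=
  Finsupp.linearCombination k (deltaChain cs k)

/-- Read a linear combination of chains `(J)` of length zero as one of subsets `J`. -/
noncomputable def toSubsets : (List (Finset (Fin n)) →₀ k) →ₗ[k] (Finset (Fin n) →₀ k) :=
  Finsupp.linearCombination k fun a =>
    match a with
    | [J] => Finsupp.single J 1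
    | _ => 0

/-- The linear map `Δ` with `Δ(a) = δ^l(a)` for a chain `a = (J₀, …, J_l)`. -/
noncomputable def Delta : (List (Finset (Fin n)) →₀ k) →ₗ[k] (Finset (Fin n) →₀ k) :=
  Finsupp.linearCombination k fun a =>
    toSubsets k (((delta cs k) ^ (a.length - 1)) (Finsupp.single a 1))

end Action

/-! ### Linear combinations of forests and of words -/

section Linear

variable (k : Type*) [Field k]

/-- A forest as an element of the space of linear combinations of forests. The multiplication of
`MonoidAlgebra k (FreeMonoid _)` is juxtaposition of sequences of trees. -/
noncomputable def ofForest {α : Type} (X : List (LeafTree α)) :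
    MonoidAlgebra k (FreeMonoid (LeafTree α)) :=
  MonoidAlgebra.of k _ (FreeMonoid.ofList X)

/-- The difference of a tree and its mirror image. -/
noncomputable def antiMirror {α : Type} (U : LeafTree α) :
    MonoidAlgebra k (FreeMonoid (LeafTree α)) :=
  ofForest k [U] - ofForest k [U.mirror]

/-- Subtract `1` from all the node labels. -/
noncomputable def lowerLabels :
    MonoidAlgebra k (FreeMonoid (LeafTree ℕ)) →ₐ[k] MonoidAlgebra k (FreeMonoid (LeafTree ℕ)) :=
  MonoidAlgebra.mapDomainAlgHom k k (FreeMonoid.map (LeafTree.map (fun x => x - 1)))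

/-- `π` on a tree: replace every node by the Lie bracket, in the algebra of words. -/
noncomputable def lieTree : LeafTree Unit → MonoidAlgebra k (FreeMonoid ℕ)
  | leaf x => MonoidAlgebra.of k _ (FreeMonoid.of x)
  | node _ l r => lieTree l * lieTree r - lieTree r * lieTree l

/-- The linear map `π` from linear combinations of unlabeled forests to linear combinations of
words, with `π(X₁ ⋯ X_j) = π(X₁) ⋯ π(X_j)`. -/
noncomputable def liePi :
    MonoidAlgebra k (FreeMonoid (LeafTree Unit)) →ₐ[k] MonoidAlgebra k (FreeMonoid ℕ) :=
  MonoidAlgebra.lift k _ _ (FreeMonoid.lift (lieTree k))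

/-- The linear extension of `φ` to linear combinations of chains. -/
noncomputable def phiChains {n : ℕ} :
    (List (Finset (Fin n)) →₀ k) →ₗ[k] MonoidAlgebra k (FreeMonoid (LeafTree ℕ)) :=
  Finsupp.linearCombination k fun a => ofForest k (chainForest a)

/-- The linear extension of `φ` to linear combinations of subsets, compositions being words. -/
noncomputable def phiSubsets {n : ℕ} :
    (Finset (Fin n) →₀ k) →ₗ[k] MonoidAlgebra k (FreeMonoid ℕ) :=
  Finsupp.linearCombination k fun J => MonoidAlgebra.of k _ (FreeMonoid.ofList (composition J))

end Linear

end DescentB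

open DescentB

/-! A Coxeter group of type B acts faithfully on ℤ by signed permutations (`signedRep_injective`).
In this model a fall of the value from position i to i + 1, with position 0 fixed, makes a generator
a right descent. The longest element of W_K therefore falls along every block of consecutive
generators of K. Since W_K cannot move points across the ends of blocks, this element must be x ↦ -x
on the first block and the reversal of every other block (`IsFirstBlock.signedRep_longest`,
`IsBlock.signedRep_longest`).

Conjugation by ω = w_J w_{J ∪ {s}} can then be computed. If s ends the first block of J, then w_J
reverses the next block, while w_{J ∪ {s}} commutes with its generators, so this block is reversed.
If s separates two later blocks, two successive reversals amount to translations that exchange these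
blocks. Compositions are handled through their partial sums, which are the ends of blocks shifted by
one. The two cases become a reversal and an exchange of segments of the composition
(`composition_conjSubset_reverse`, `composition_conjSubset_swap`).

A labeled forest is determined by its levels: contracting all subtrees whose root label exceeds m
gives the composition of J_m (`levels_chainForest`, `chainForest_eq_of_levels`). All levels of a
tree have the same sum, so one generator acts on the same segments at every level; it mirrors a tree
or exchanges two trees. This is the first claim.

Omitting J_0 from a chain removes the node labeled 1, and the generator lost from J_0 is the cut
between its two children. The second claim follows from the first. For the third, induction on the
number of nodes (`phiSubsets_Delta`) shows that removing a root on the left branch of the first tree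
contributes a tree minus its mirror image, and removing any other root contributes a Lie bracket.
Since mirroring a tree multiplies its bracket by -1 for each node (`lieTree_mirror`), every such
difference contributes a factor 2 or vanishes. -/

open DescentB
namespace DescentB

/-! ### Type `B` groups as groups of signed permutations -/

/-- The generators of the group of signed permutations, as functions on `ℤ`: the first one negates
`1` and the `i`-th one exchanges `i` and `i + 1`. -/
def signedFun (i : ℕ) (x : ℤ) : ℤ :=
  if i = 0 then (if x = 1 then -1 else if x = -1 then 1 else x)
  else if x = i then i + 1 else if x = i + 1 then i
  else if x = -i then -(i + 1) else if x = -(i + 1) then -i else x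

lemma signedFun_signedFun (i : ℕ) (x : ℤ) : signedFun i (signedFun i x) = x := by
  unfold signedFun; grind

lemma signedFun_neg (i : ℕ) (x : ℤ) : signedFun i (-x) = -signedFun i x := by
  unfold signedFun; grind

/-- The generators of the group of signed permutations. -/
def signedPerm (i : ℕ) : Equiv.Perm ℤ where
  toFun := signedFun i
  invFun := signedFun i
  left_inv := signedFun_signedFun i
  right_inv := signedFun_signedFun i

lemma signedPerm_apply (i : ℕ) (x : ℤ) : signedPerm i x = signedFun i x := rfl

lemma signedPerm_mul_self (i : ℕ) : signedPerm i * signedPerm i = 1 :=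
  Equiv.ext (signedFun_signedFun i)

/-- A description by linear constraints, so that identities between products of generators reduce to
case splits closed by linear arithmetic. -/
lemma signedFun_cases (i : ℕ) (x : ℤ) :
    (i = 0 ∧ x = 1 ∧ signedFun i x = -1) ∨ (i = 0 ∧ x = -1 ∧ signedFun i x = 1) ∨
    (0 < i ∧ x = i ∧ signedFun i x = i + 1) ∨ (0 < i ∧ x = i + 1 ∧ signedFun i x = i) ∨
    (0 < i ∧ x = -i ∧ signedFun i x = -(i + 1)) ∨ (0 < i ∧ x = -(i + 1) ∧ signedFun i x = -i) ∨
    (x ≠ i + 1 ∧ x ≠ -(i + 1) ∧ (0 < i → x ≠ i ∧ x ≠ -i) ∧ signedFun i x = x) := by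
  unfold signedFun; split_ifs <;> omega

lemma signedPerm_comm {i j : ℕ} (h : i + 1 < j) :
    signedPerm i * signedPerm j = signedPerm j * signedPerm i := by
  ext x
  simp only [Equiv.Perm.mul_apply, signedPerm_apply]
  have h1 := signedFun_cases i x
  have h2 := signedFun_cases j x
  have h3 := signedFun_cases i (signedFun j x)
  have h4 := signedFun_cases j (signedFun i x)
  generalize signedFun i (signedFun j x) = c at *
  generalize signedFun j (signedFun i x) = d at *
  generalize signedFun i x = a at *
  generalize signedFun j x = b at *
  rcases h1 with h1 | h1 | h1 | h1 | h1 | h1 | h1 <;>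
  rcases h2 with h2 | h2 | h2 | h2 | h2 | h2 | h2 <;> omega

lemma signedPerm_braid {i : ℕ} (h : 0 < i) :
    signedPerm i * signedPerm (i + 1) * signedPerm i =
      signedPerm (i + 1) * signedPerm i * signedPerm (i + 1) := by
  ext x
  simp only [Equiv.Perm.mul_apply, signedPerm_apply]
  have h1 := signedFun_cases i x
  have h2 := signedFun_cases (i + 1) x
  have h3 := signedFun_cases (i + 1) (signedFun i x)
  have h4 := signedFun_cases i (signedFun (i + 1) x)
  have h5 := signedFun_cases i (signedFun (i + 1) (signedFun i x))
  have h6 := signedFun_cases (i + 1) (signedFun i (signedFun (i + 1) x))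
  generalize signedFun i (signedFun (i + 1) (signedFun i x)) = e at *
  generalize signedFun (i + 1) (signedFun i (signedFun (i + 1) x)) = f at *
  generalize signedFun (i + 1) (signedFun i x) = c at *
  generalize signedFun i (signedFun (i + 1) x) = d at *
  generalize signedFun i x = a at *
  generalize signedFun (i + 1) x = b at *
  rcases h1 with h1 | h1 | h1 | h1 | h1 | h1 | h1 <;>
  rcases h2 with h2 | h2 | h2 | h2 | h2 | h2 | h2 <;> omega

lemma signedPerm_braid_four :
    signedPerm 0 * signedPerm 1 * signedPerm 0 * signedPerm 1 =
      signedPerm 1 * signedPerm 0 * signedPerm 1 * signedPerm 0 := by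
  ext x
  simp only [Equiv.Perm.mul_apply, signedPerm_apply, signedFun]
  by_cases h1 : x = 1
  · subst h1; decide
  by_cases h2 : x = 2
  · subst h2; decide
  by_cases h3 : x = -1
  · subst h3; decide
  by_cases h4 : x = -2
  · subst h4; decide
  simp [h1, h2, h3, h4]

lemma typeB_apply {n : ℕ} (i j : Fin n) : typeB n i j =
    if i = j then 1 else if (i : ℕ) = 0 ∧ (j : ℕ) = 1 ∨ (i : ℕ) = 1 ∧ (j : ℕ) = 0 then 4
    else if (i : ℕ) + 1 = j ∨ (j : ℕ) + 1 = i then 3 else 2 := by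
  have hi := i.2
  have hj := j.2
  simp only [typeB, CoxeterMatrix.reindex_apply]
  simp only [CoxeterMatrix.B, Matrix.of_apply, Fin.revPerm_symm, Fin.revPerm_apply,
    Fin.rev_inj, Fin.val_rev]
  grind

lemma signedPerm_isLiftable (n : ℕ) :
    (typeB n).IsLiftable (fun i : Fin n => signedPerm i) := by
  -- The case j < i follows from this one by inversion, because the generators are involutions.
  have key : ∀ i j : Fin n, i < j →
      (signedPerm i * signedPerm j : Equiv.Perm ℤ) ^ (typeB n i j) = 1 := by
    intro i j hij
    have hij' : (i : ℕ) < j := hij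
    have e1 := signedPerm_mul_self i
    have e2 := signedPerm_mul_self j
    rw [typeB_apply]
    have h0 : i ≠ j := hij.ne
    by_cases h4 : (i : ℕ) = 0 ∧ (j : ℕ) = 1
    · have := signedPerm_braid_four
      rw [if_neg h0, if_pos (by omega), h4.1, h4.2]
      rw [h4.1] at e1
      rw [h4.2] at e2
      calc _ = (signedPerm 0 * signedPerm 1 * signedPerm 0 * signedPerm 1) *
            (signedPerm 0 * signedPerm 1 * signedPerm 0 * signedPerm 1) := by
              simp only [pow_succ, pow_zero, one_mul, mul_assoc]
        _ = (signedPerm 1 * signedPerm 0 * signedPerm 1 * signedPerm 0) *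
            (signedPerm 0 * signedPerm 1 * signedPerm 0 * signedPerm 1) := by rw [← this]
        _ = signedPerm 1 * (signedPerm 0 * (signedPerm 1 * (signedPerm 0 *
            signedPerm 0) * signedPerm 1) * signedPerm 0) * signedPerm 1 := by group
        _ = 1 := by simp [e1, e2]
    · by_cases h3 : (i : ℕ) + 1 = j
      · have hp : 0 < (i : ℕ) := by omega
        have := signedPerm_braid hp
        rw [← h3] at e2
        rw [if_neg h0, if_neg (by omega), if_pos (by omega), ← h3]
        calc _ = (signedPerm i * signedPerm (i + 1) * signedPerm i) *
              (signedPerm (i + 1) * signedPerm i * signedPerm (i + 1)) := by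
              simp only [pow_succ, pow_zero, one_mul, mul_assoc]
          _ = (signedPerm (i + 1) * signedPerm i * signedPerm (i + 1)) *
              (signedPerm (i + 1) * signedPerm i * signedPerm (i + 1)) := by rw [← this]
          _ = signedPerm (i + 1) * (signedPerm i * (signedPerm (i + 1) * signedPerm (i + 1)) *
              signedPerm i) * signedPerm (i + 1) := by group
          _ = 1 := by simp [e1, e2]
      · rw [if_neg h0, if_neg (by omega), if_neg (by omega)]
        have := signedPerm_comm (i := i) (j := j) (by omega)
        rw [pow_two]
        nth_rw 2 [this]
        rw [mul_assoc, ← mul_assoc (signedPerm j), e2, one_mul, e1]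
  intro i j
  rcases lt_trichotomy i j with h | h | h
  · exact key i j h
  · subst h; simp [signedPerm_mul_self]
  · have := key j i h
    rw [(typeB n).symmetric i j]
    have h2 : (signedPerm i * signedPerm j) =
        (signedPerm j * signedPerm i : Equiv.Perm ℤ)⁻¹ := by
      rw [mul_inv_rev, inv_eq_of_mul_eq_one_left (signedPerm_mul_self i),
        inv_eq_of_mul_eq_one_left (signedPerm_mul_self j)]
    rw [h2, inv_pow, this, inv_one]

/-! ### The homomorphism to signed permutations and the defining relations -/

section Representation

variable {n : ℕ} {W : Type*} [Group W] (cs : CoxeterSystem (typeB n) W)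

/-- The homomorphism to the group of signed permutations. -/
noncomputable def signedRep : W →* Equiv.Perm ℤ :=
  cs.lift ⟨fun i => signedPerm i, signedPerm_isLiftable n⟩

lemma signedRep_simple (i : Fin n) : signedRep cs (cs.simple i) = signedPerm i :=
  cs.lift_apply_simple (signedPerm_isLiftable n) i

lemma signedPerm_injective {i j : ℕ} (h : signedPerm i = signedPerm j) : i = j := by
  have h1 := congrArg (fun f : Equiv.Perm ℤ => f (i + 1)) h
  have h2 := congrArg (fun f : Equiv.Perm ℤ => f (j + 1)) h
  simp only [signedPerm_apply, signedFun] at h1 h2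
  grind

lemma simple_injective : Function.Injective cs.simple := fun i j h => by
  have := congrArg (signedRep cs) h
  rw [signedRep_simple, signedRep_simple] at this
  exact Fin.ext (signedPerm_injective this)

lemma signedRep_neg (w : W) (x : ℤ) : signedRep cs w (-x) = -signedRep cs w x := by
  induction w using cs.simple_induction_left generalizing x with
  | one => simp
  | mul_simple_left w i ih =>
    rw [map_mul, signedRep_simple, Equiv.Perm.mul_apply, Equiv.Perm.mul_apply, ih,
      signedPerm_apply, signedPerm_apply, signedFun_neg]

lemma signedRep_zero (w : W) : signedRep cs w 0 = 0 := by
  have := signedRep_neg cs w 0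
  simp only [neg_zero] at this
  omega

lemma simple_comm {i j : Fin n} (h : (i : ℕ) + 1 < j) :
    cs.simple i * cs.simple j = cs.simple j * cs.simple i := by
  have := cs.simple_mul_simple_pow i j
  rw [typeB_apply, if_neg (by rintro rfl; omega), if_neg (by omega), if_neg (by omega)] at this
  rw [pow_two] at this
  calc _ = (cs.simple i * cs.simple j)⁻¹ := (inv_eq_of_mul_eq_one_left this).symm
    _ = _ := by simp

lemma simple_braid {i j : Fin n} (h : (i : ℕ) + 1 = j) (h0 : 0 < (i : ℕ)) :
    cs.simple i * cs.simple j * cs.simple i = cs.simple j * cs.simple i * cs.simple j := by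
  have := cs.simple_mul_simple_pow i j
  rw [typeB_apply, if_neg (by rintro rfl; omega), if_neg (by omega), if_pos (by omega)] at this
  have h2 : (cs.simple i * cs.simple j * cs.simple i) *
      (cs.simple j * cs.simple i * cs.simple j) = 1 := by
    rw [← this]; simp only [pow_succ, pow_zero, one_mul, mul_assoc]
  rw [mul_eq_one_iff_eq_inv] at h2
  simpa [mul_assoc] using h2

lemma simple_braid_four {i j : Fin n} (hi : (i : ℕ) = 0) (hj : (j : ℕ) = 1) :
    cs.simple i * cs.simple j * cs.simple i * cs.simple j =
      cs.simple j * cs.simple i * cs.simple j * cs.simple i := by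
  have := cs.simple_mul_simple_pow i j
  rw [typeB_apply, if_neg (by rintro rfl; omega), if_pos (by omega)] at this
  have h2 : (cs.simple i * cs.simple j * cs.simple i * cs.simple j) *
      (cs.simple i * cs.simple j * cs.simple i * cs.simple j) = 1 := by
    rw [← this]; simp only [pow_succ, pow_zero, one_mul, mul_assoc]
  rw [mul_eq_one_iff_eq_inv] at h2
  simpa [mul_assoc] using h2

end Representation

/-! ### Coset normal forms and faithfulness -/

section Injective

variable {n : ℕ} {W : Type*} [Group W] (cs : CoxeterSystem (typeB n) W)

/-- The simple reflections, indexed by natural numbers. -/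
noncomputable def gen (i : ℕ) : W := if h : i < n then cs.simple ⟨i, h⟩ else 1

lemma gen_mul_self (i : ℕ) : gen cs i * gen cs i = 1 := by
  unfold gen; split_ifs <;> simp

lemma gen_mul_gen_mul (i : ℕ) (w : W) : gen cs i * (gen cs i * w) = w := by
  rw [← mul_assoc, gen_mul_self, one_mul]

/-- No bounds on the indices are needed, since generators out of range are 1. -/
lemma gen_comm {i j : ℕ} (h : i + 1 < j ∨ j + 1 < i) :
    gen cs i * gen cs j = gen cs j * gen cs i := by
  unfold gen
  split_ifs with hi hj
  · rcases h with h | h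
    · exact simple_comm cs (i := ⟨i, hi⟩) (j := ⟨j, hj⟩) h
    · exact (simple_comm cs (i := ⟨j, hj⟩) (j := ⟨i, hi⟩) h).symm
  all_goals simp

lemma gen_braid {i : ℕ} (h0 : 0 < i) (h : i + 1 < n) :
    gen cs i * gen cs (i + 1) * gen cs i = gen cs (i + 1) * gen cs i * gen cs (i + 1) := by
  simp only [gen, h, show i < n by omega, dif_pos]
  exact simple_braid cs (i := ⟨i, by omega⟩) (j := ⟨i + 1, h⟩) rfl h0

lemma gen_braid_four (h : 1 < n) :
    gen cs 0 * gen cs 1 * gen cs 0 * gen cs 1 = gen cs 1 * gen cs 0 * gen cs 1 * gen cs 0 := by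
  simp only [gen, h, show 0 < n by omega, dif_pos]
  exact simple_braid_four cs (i := ⟨0, by omega⟩) (j := ⟨1, h⟩) rfl rfl

/-- The element `s_{m-d+1} ⋯ s_m`, mapping the point `m + 1` to `m + 1 - d`. -/
noncomputable def posCoset (m : ℕ) : ℕ → W
  | 0 => 1
  | d + 1 => gen cs (m - d) * posCoset m d

/-- The element `s_p ⋯ s_0 s_1 ⋯ s_m`, mapping the point `m + 1` to `-(p + 1)`. -/
noncomputable def negCoset (m : ℕ) : ℕ → W
  | 0 => gen cs 0 * posCoset cs m m
  | p + 1 => gen cs (p + 1) * negCoset m p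

lemma gen_mul_posCoset_of_lt {m d i : ℕ} (h : i + d < m) :
    gen cs i * posCoset cs m d = posCoset cs m d * gen cs i := by
  induction d with
  | zero => simp [posCoset]
  | succ d ih =>
    rw [posCoset, ← mul_assoc, gen_comm cs (by omega), mul_assoc, ih (by omega), mul_assoc]

/-- The factor s_i commutes to the right until it meets s_{i-1} s_i. The braid relation turns s_i
s_{i-1} s_i into s_{i-1} s_i s_{i-1}, and the last s_{i-1} commutes with what remains. -/
lemma gen_mul_posCoset_of_gt {m d i : ℕ} (hm : m < n) (hd : d ≤ m) (hi : m + 1 < i + d)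
    (him : i ≤ m) : gen cs i * posCoset cs m d = posCoset cs m d * gen cs (i - 1) := by
  induction d with
  | zero => omega
  | succ d ih =>
    by_cases h : m + 1 < i + d
    · rw [posCoset, ← mul_assoc, gen_comm cs (by omega), mul_assoc, ih (by omega) h, mul_assoc]
    · obtain ⟨e, rfl⟩ : ∃ e, d = e + 1 := ⟨d - 1, by omega⟩
      obtain ⟨q, rfl⟩ : ∃ q, i = q + 1 := ⟨i - 1, by omega⟩
      have e1 : m - (e + 1) = q := by omega
      have e2 : m - e = q + 1 := by omega
      have := gen_braid cs (i := q) (by omega) (by omega)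
      rw [posCoset, posCoset, e1, e2, ← mul_assoc, ← mul_assoc, ← this, mul_assoc,
        gen_mul_posCoset_of_lt cs (by omega)]
      simp only [mul_assoc, Nat.add_sub_cancel]

lemma gen_mul_negCoset_of_gt {m p i : ℕ} (hm : m < n) (hi : p + 2 ≤ i)
    (him : i ≤ m) : gen cs i * negCoset cs m p = negCoset cs m p * gen cs (i - 1) := by
  induction p with
  | zero =>
    rw [negCoset, ← mul_assoc, gen_comm cs (by omega), mul_assoc,
      gen_mul_posCoset_of_gt cs hm le_rfl (by omega) him, mul_assoc]
  | succ p ih =>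
    rw [negCoset, ← mul_assoc, gen_comm cs (by omega), mul_assoc, ih (by omega), mul_assoc]

/-- On the descending part s_p ⋯ s_0 a braid relation turns s_i into s_{i+1}, and on the ascending
part another one turns it back. For i = 0 both happen at once, in the relation of order 4. -/
lemma gen_mul_negCoset_of_lt {m p i : ℕ} (hm : m < n) (hp : p ≤ m) (hi : i < p) :
    gen cs i * negCoset cs m p = negCoset cs m p * gen cs i := by
  induction p with
  | zero => omega
  | succ p ih =>
    by_cases h : i < p
    · rw [negCoset, ← mul_assoc, gen_comm cs (by omega), mul_assoc, ih (by omega) h, mul_assoc]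
    · obtain rfl : i = p := by omega
      cases i with
      | zero =>
        obtain ⟨e, rfl⟩ : ∃ e, m = e + 1 := ⟨m - 1, by omega⟩
        have := gen_braid_four cs (by omega)
        rw [negCoset, negCoset, posCoset, show e + 1 - e = 1 by omega]
        calc _ = gen cs 0 * gen cs 1 * gen cs 0 * gen cs 1 * posCoset cs (e + 1) e := by
              simp only [mul_assoc, zero_add]
          _ = gen cs 1 * gen cs 0 * gen cs 1 * (gen cs 0 * posCoset cs (e + 1) e) := by
              rw [this, mul_assoc]
          _ = _ := by
              rw [gen_mul_posCoset_of_lt cs (by omega)]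
              simp only [mul_assoc, zero_add]
      | succ i =>
        have := gen_braid cs (i := i + 1) (by omega) (by omega)
        rw [negCoset, negCoset, ← mul_assoc, ← mul_assoc, this, mul_assoc,
          gen_mul_negCoset_of_gt cs hm (by omega) (by omega)]
        simp only [mul_assoc, Nat.add_sub_cancel]

/-- The subgroup generated by the first `m` simple reflections. -/
noncomputable def genSubgroup (m : ℕ) : Subgroup W := Subgroup.closure (gen cs '' Set.Iio m)

lemma gen_mem_genSubgroup {m i : ℕ} (h : i < m) : gen cs i ∈ genSubgroup cs m :=
  Subgroup.subset_closure ⟨i, h, rfl⟩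

/-- The products of a representative and an element of the smaller subgroup are stable under left
multiplication by generators: a generator either leads to a neighbouring representative or passes
through and is absorbed by the subgroup. -/
lemma exists_coset {m : ℕ} (hm : m < n) {w : W} (hw : w ∈ genSubgroup cs (m + 1)) :
    ∃ u ∈ genSubgroup cs m, (∃ d ≤ m, w = posCoset cs m d * u) ∨
      (∃ p ≤ m, w = negCoset cs m p * u) := by
  have key : ∀ i ≤ m, ∀ w, (∃ u ∈ genSubgroup cs m, (∃ d ≤ m, w = posCoset cs m d * u) ∨
      (∃ p ≤ m, w = negCoset cs m p * u)) → ∃ u ∈ genSubgroup cs m,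
      (∃ d ≤ m, gen cs i * w = posCoset cs m d * u) ∨
      (∃ p ≤ m, gen cs i * w = negCoset cs m p * u) := by
    rintro i hi w ⟨u, hu, ⟨d, hd, rfl⟩ | ⟨p, hp, rfl⟩⟩
    · rcases lt_trichotomy (i + d) m with h | h | h
      · refine ⟨gen cs i * u, mul_mem (gen_mem_genSubgroup cs (by omega)) hu, Or.inl ⟨d, hd, ?_⟩⟩
        rw [← mul_assoc, gen_mul_posCoset_of_lt cs h, mul_assoc]
      · by_cases hdm : d = m
        · obtain rfl : i = 0 := by omega
          refine ⟨u, hu, Or.inr ⟨0, by omega, ?_⟩⟩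
          rw [negCoset, hdm, mul_assoc]
        · refine ⟨u, hu, Or.inl ⟨d + 1, by omega, ?_⟩⟩
          rw [posCoset, show m - d = i by omega, mul_assoc]
      · by_cases h' : m + 1 < i + d
        · refine ⟨gen cs (i - 1) * u, mul_mem (gen_mem_genSubgroup cs (by omega)) hu,
            Or.inl ⟨d, hd, ?_⟩⟩
          rw [← mul_assoc, gen_mul_posCoset_of_gt cs hm hd h' hi, mul_assoc]
        · obtain ⟨e, rfl⟩ : ∃ e, d = e + 1 := ⟨d - 1, by omega⟩
          refine ⟨u, hu, Or.inl ⟨e, by omega, ?_⟩⟩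
          rw [posCoset, show m - e = i by omega, mul_assoc, gen_mul_gen_mul]
    · rcases lt_trichotomy i p with h | h | h
      · refine ⟨gen cs i * u, mul_mem (gen_mem_genSubgroup cs (by omega)) hu, Or.inr ⟨p, hp, ?_⟩⟩
        rw [← mul_assoc, gen_mul_negCoset_of_lt cs hm hp h, mul_assoc]
      · subst h
        cases i with
        | zero =>
          refine ⟨u, hu, Or.inl ⟨m, le_rfl, ?_⟩⟩
          rw [negCoset, mul_assoc, gen_mul_gen_mul]
        | succ i =>
          refine ⟨u, hu, Or.inr ⟨i, by omega, ?_⟩⟩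
          rw [negCoset, mul_assoc, gen_mul_gen_mul]
      · by_cases h' : p + 2 ≤ i
        · refine ⟨gen cs (i - 1) * u, mul_mem (gen_mem_genSubgroup cs (by omega)) hu,
            Or.inr ⟨p, hp, ?_⟩⟩
          rw [← mul_assoc, gen_mul_negCoset_of_gt cs hm h' hi, mul_assoc]
        · obtain rfl : i = p + 1 := by omega
          refine ⟨u, hu, Or.inr ⟨p + 1, by omega, ?_⟩⟩
          rw [negCoset, mul_assoc]
  induction hw using Subgroup.closure_induction_left with
  | one => exact ⟨1, one_mem _, Or.inl ⟨0, by omega, by simp [posCoset]⟩⟩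
  | mul_left x hx y hy ih =>
    obtain ⟨i, hi, rfl⟩ := hx
    exact key i (Nat.lt_succ_iff.1 hi) y ih
  | inv_mul_cancel x hx y hy ih =>
    obtain ⟨i, hi, rfl⟩ := hx
    rw [inv_eq_of_mul_eq_one_left (gen_mul_self cs i)]
    exact key i (Nat.lt_succ_iff.1 hi) y ih

lemma signedRep_gen {i : ℕ} (h : i < n) (x : ℤ) : signedRep cs (gen cs i) x = signedFun i x := by
  rw [gen, dif_pos h, signedRep_simple, signedPerm_apply]

lemma signedRep_posCoset {m d : ℕ} (hm : m < n) (hd : d ≤ m) :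
    signedRep cs (posCoset cs m d) (m + 1) = m + 1 - d := by
  induction d with
  | zero => simp [posCoset]
  | succ d ih =>
    rw [posCoset, map_mul, Equiv.Perm.mul_apply, ih (by omega), signedRep_gen cs (by omega)]
    unfold signedFun; split_ifs <;> omega

lemma signedRep_negCoset {m p : ℕ} (hm : m < n) (hp : p ≤ m) :
    signedRep cs (negCoset cs m p) (m + 1) = -(p + 1) := by
  induction p with
  | zero =>
    rw [negCoset, map_mul, Equiv.Perm.mul_apply, signedRep_posCoset cs hm le_rfl,
      signedRep_gen cs (by omega)]
    unfold signedFun; split_ifs <;> omega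
  | succ p ih =>
    rw [negCoset, map_mul, Equiv.Perm.mul_apply, ih (by omega), signedRep_gen cs (by omega)]
    unfold signedFun; split_ifs <;> first | contradiction | omega

lemma signedRep_apply_of_gt {m : ℕ} (hm : m ≤ n) {w : W} (hw : w ∈ genSubgroup cs m) {x : ℤ}
    (hx : (m : ℤ) < x) : signedRep cs w x = x := by
  have hg : ∀ i < m, signedRep cs (gen cs i) x = x := fun i hi => by
    rw [signedRep_gen cs (by omega)]
    unfold signedFun; split_ifs <;> omega
  induction hw using Subgroup.closure_induction with
  | mem y hy => obtain ⟨i, hi, rfl⟩ := hy; exact hg i hi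
  | one => simp
  | mul y z _ _ h1 h2 => rw [map_mul, Equiv.Perm.mul_apply, h2, h1]
  | inv y _ h => rw [map_inv, Equiv.Perm.inv_eq_iff_eq, h]

/-- The smaller subgroup fixes the point m + 1, so the image of this point reveals the coset
representative. If the point is fixed, the representative is 1, and induction applies. -/
lemma eq_one_of_signedRep_eq_one {m : ℕ} (hm : m ≤ n) {w : W} (hw : w ∈ genSubgroup cs m)
    (h : signedRep cs w = 1) : w = 1 := by
  induction m generalizing w with
  | zero => simpa [genSubgroup] using hw
  | succ m ih =>
    obtain ⟨u, hu, ⟨d, hd, rfl⟩ | ⟨p, hp, rfl⟩⟩ := exists_coset cs (by omega) hw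
    · have h1 := congrArg (fun f : Equiv.Perm ℤ => f (m + 1)) h
      simp only [map_mul, Equiv.Perm.mul_apply, Equiv.Perm.one_apply,
        signedRep_apply_of_gt cs (by omega) hu (show (m : ℤ) < m + 1 by omega),
        signedRep_posCoset cs (show m < n by omega) hd] at h1
      obtain rfl : d = 0 := by omega
      simp only [posCoset, one_mul] at h ⊢
      exact ih (by omega) hu h
    · have h1 := congrArg (fun f : Equiv.Perm ℤ => f (m + 1)) h
      simp only [map_mul, Equiv.Perm.mul_apply, Equiv.Perm.one_apply,
        signedRep_apply_of_gt cs (by omega) hu (show (m : ℤ) < m + 1 by omega),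
        signedRep_negCoset cs (show m < n by omega) hp] at h1
      omega

lemma genSubgroup_eq_top : genSubgroup cs n = ⊤ := by
  rw [eq_top_iff, ← cs.subgroup_closure_range_simple, Subgroup.closure_le]
  rintro _ ⟨i, rfl⟩
  have := gen_mem_genSubgroup cs i.2
  rwa [gen, dif_pos i.2] at this

/-- Type `B` Coxeter groups act faithfully by signed permutations. -/
theorem signedRep_injective : Function.Injective (signedRep cs) := by
  rw [injective_iff_map_eq_one]
  intro w hw
  exact eq_one_of_signedRep_eq_one cs le_rfl (by rw [genSubgroup_eq_top]; trivial) hw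

end Injective

/-! ### Descents, and the longest elements of parabolic subgroups -/

section Longest

variable {n : ℕ} {W : Type*} [Group W] (cs : CoxeterSystem (typeB n) W)

lemma signedRep_eq_self_of_gt (w : W) {x : ℤ} (hx : (n : ℤ) < x) : signedRep cs w x = x :=
  signedRep_apply_of_gt cs le_rfl (by rw [genSubgroup_eq_top]; trivial) hx

lemma signedRep_le (w : W) {x : ℤ} (hx : x ≤ n) : signedRep cs w x ≤ n := by
  by_contra! h
  have h1 := signedRep_eq_self_of_gt cs w h
  have := (signedRep cs w).injective h1
  omega

/-- By faithfulness and oddness an element is determined by the images of 1, …, n, which lie between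
-n and n. -/
lemma finite_of_typeB (cs : CoxeterSystem (typeB n) W) : Finite W := by
  have hb : ∀ (w : W) (i : Fin n), signedRep cs w (i + 1) ∈ Set.Icc (-n : ℤ) n := fun w i => by
    have h1 := signedRep_le cs w (x := i + 1) (by have := i.2; omega)
    have h2 := signedRep_le cs w (x := -(i + 1)) (by omega)
    rw [signedRep_neg] at h2
    exact ⟨by omega, h1⟩
  let F : W → (Fin n → Set.Icc (-n : ℤ) n) := fun w i => ⟨signedRep cs w (i + 1), hb w i⟩
  refine Finite.of_injective F fun v w hvw => signedRep_injective cs ?_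
  have hpos : ∀ x : ℤ, 0 < x → signedRep cs v x = signedRep cs w x := fun x hx => by
    by_cases hxn : x ≤ n
    · have := congrArg Subtype.val (congrFun hvw ⟨(x - 1).toNat, by omega⟩)
      have e : (((x - 1).toNat : ℕ) : ℤ) + 1 = x := by omega
      simpa only [F, e] using this
    · rw [signedRep_eq_self_of_gt cs v (by omega), signedRep_eq_self_of_gt cs w (by omega)]
  ext x
  rcases lt_trichotomy 0 x with h | h | h
  · exact hpos x h
  · rw [← h, signedRep_zero, signedRep_zero]
  · have := hpos (-x) (by omega)
    rw [signedRep_neg, signedRep_neg] at this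
    omega

/-- The conjugate of s_r by v is the reflection that exchanges the images under v of the points r
and r + 1, or negates the image of 1. The hypothesis lists the cases in which this reflection is
s_k. -/
lemma mul_simple_eq_simple_mul {v : W} {r k : Fin n}
    (h : ((r : ℕ) = 0 ∧ (k : ℕ) = 0 ∧
        (signedRep cs v (r + 1) = 1 ∨ signedRep cs v (r + 1) = -1)) ∨
      (0 < (r : ℕ) ∧ 0 < (k : ℕ) ∧
        ((signedRep cs v r = k ∧ signedRep cs v (r + 1) = k + 1) ∨
        (signedRep cs v r = k + 1 ∧ signedRep cs v (r + 1) = k) ∨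
        (signedRep cs v r = -k ∧ signedRep cs v (r + 1) = -(k + 1)) ∨
        (signedRep cs v r = -(k + 1) ∧ signedRep cs v (r + 1) = -k)))) :
    v * cs.simple r = cs.simple k * v := by
  apply signedRep_injective cs
  ext x
  simp only [map_mul, Equiv.Perm.mul_apply, signedRep_simple, signedPerm_apply]
  have i1 := (signedRep cs v).injective.eq_iff (a := x) (b := (r : ℤ))
  have i2 := (signedRep cs v).injective.eq_iff (a := x) (b := (r : ℤ) + 1)
  have i3 := (signedRep cs v).injective.eq_iff (a := x) (b := -(r : ℤ))
  have i4 := (signedRep cs v).injective.eq_iff (a := x) (b := -((r : ℤ) + 1))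
  have h1 := signedRep_neg cs v r
  have h2 := signedRep_neg cs v (r + 1)
  have c1 := signedFun_cases r x
  have c2 := signedFun_cases k (signedRep cs v x)
  rcases c1 with ⟨g1, g2, g3⟩ | ⟨g1, g2, g3⟩ | ⟨g1, g2, g3⟩ | ⟨g1, g2, g3⟩ | ⟨g1, g2, g3⟩ |
    ⟨g1, g2, g3⟩ | ⟨g1, g2, g3, g4⟩
  · have e : x = r + 1 := by omega
    have e' : signedFun r x = -(r + 1) := by omega
    rw [e', h2]; rw [e] at c2 ⊢; omega
  · have e : x = -(r + 1) := by omega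
    have e' : signedFun r x = r + 1 := by omega
    rw [e']; rw [e, h2] at c2 ⊢; omega
  · rw [g3]; rw [g2] at c2 ⊢; omega
  · rw [g3]; rw [g2] at c2 ⊢; omega
  · rw [g3, h2]; rw [g2, h1] at c2 ⊢; omega
  · rw [g3, h1]; rw [g2, h2] at c2 ⊢; omega
  · rw [g4]
    rw [h1] at i3
    rw [h2] at i4
    omega

/-- The generator `i` is a right descent of `w` as soon as the signed permutation of `w` has a
descent at `i`. -/
lemma exists_word_of_descent (ω : List (Fin n)) (i : Fin n)
    (h : signedRep cs (cs.wordProd ω) (i + 1) < signedRep cs (cs.wordProd ω) i) :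
    ∃ ω' : List (Fin n), ω'.length + 1 = ω.length ∧
      cs.wordProd ω * cs.simple i = cs.wordProd ω' := by
  induction ω with
  | nil => simp at h
  | cons k ω ih =>
    rw [cs.wordProd_cons] at h ⊢
    by_cases h' : signedRep cs (cs.wordProd ω) (i + 1) < signedRep cs (cs.wordProd ω) i
    · obtain ⟨ω', h1, h2⟩ := ih h'
      exact ⟨k :: ω', by simp [← h1], by rw [mul_assoc, h2, cs.wordProd_cons]⟩
    -- Prefixing s_k creates the descent, so s_k interchanges the order of the two values. It is
    -- then the conjugate of s_i by the remaining word, and it cancels.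
    · refine ⟨ω, by simp, ?_⟩
      have key : cs.wordProd ω * cs.simple i = cs.simple k * cs.wordProd ω := by
        apply mul_simple_eq_simple_mul
        simp only [map_mul, Equiv.Perm.mul_apply, signedRep_simple, signedPerm_apply] at h
        have h0 := signedRep_zero cs (cs.wordProd ω)
        have i1 := (signedRep cs (cs.wordProd ω)).injective.eq_iff (a := (i : ℤ)) (b := 0)
        have i2 := (signedRep cs (cs.wordProd ω)).injective.eq_iff (a := (i : ℤ) + 1) (b := 0)
        have i3 := (signedRep cs (cs.wordProd ω)).injective.eq_iff (a := (i : ℤ) + 1) (b := -i)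
        rw [h0] at i1 i2
        rw [signedRep_neg] at i3
        have c1 := signedFun_cases k (signedRep cs (cs.wordProd ω) i)
        have c2 := signedFun_cases k (signedRep cs (cs.wordProd ω) (i + 1))
        clear ih
        generalize signedRep cs (cs.wordProd ω) i = a at *
        generalize signedRep cs (cs.wordProd ω) (i + 1) = b at *
        rcases c1 with c1 | c1 | c1 | c1 | c1 | c1 | c1 <;>
        rcases c2 with c2 | c2 | c2 | c2 | c2 | c2 | c2 <;> omega
      rw [mul_assoc, key, cs.simple_mul_simple_cancel_left]

lemma length_mul_simple_lt_of_descent {w : W} {i : Fin n}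
    (h : signedRep cs w (i + 1) < signedRep cs w i) :
    cs.length (w * cs.simple i) < cs.length w := by
  obtain ⟨ω, hω, rfl⟩ := cs.exists_isReduced w
  obtain ⟨ω', h1, h2⟩ := exists_word_of_descent cs ω i h
  rw [h2, hω.eq, ← h1]
  exact Nat.lt_succ_of_le (cs.length_wordProd_le ω')

lemma isLongest_longest (K : Finset (Fin n)) : IsLongest cs K (longest cs K) := by
  have := finite_of_typeB cs
  obtain ⟨w, hw, h⟩ := Set.exists_max_image (parabolic cs K : Set W) cs.length
    (Set.toFinite _) ⟨1, one_mem _⟩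
  exact Classical.epsilon_spec ⟨w, hw, h⟩

lemma simple_mem_parabolic {K : Finset (Fin n)} {i : Fin n} (h : i ∈ K) :
    cs.simple i ∈ parabolic cs K := Subgroup.subset_closure ⟨i, h, rfl⟩

/-- Otherwise w s_i, which still lies in W_K, would have a descent at i and hence be longer than w.
-/
lemma IsLongest.descent {K : Finset (Fin n)} {w : W} (hw : IsLongest cs K w) {i : Fin n}
    (hi : i ∈ K) : signedRep cs w (i + 1) < signedRep cs w i := by
  have h1 := hw.2 _ (mul_mem hw.1 (simple_mem_parabolic cs hi))
  by_contra! h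
  have h2 : signedRep cs (w * cs.simple i) (i + 1) < signedRep cs (w * cs.simple i) i := by
    simp only [map_mul, Equiv.Perm.mul_apply, signedRep_simple, signedPerm_apply]
    have h0 := signedRep_zero cs w
    have i1 := (signedRep cs w).injective.eq_iff (a := (i : ℤ) + 1) (b := i)
    have h3 := signedRep_neg cs w (i + 1)
    -- For the sign change the comparison is with the value 0 at position 0, so a descent means a
    -- negative value at position 1.
    by_cases hi0 : (i : ℕ) = 0
    · have e1 : signedFun i (i + 1) = -(i + 1) := by
        have := signedFun_cases i (i + 1)
        omega
      have e2 : signedFun i i = i := by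
        have := signedFun_cases i i
        omega
      have e3 : signedRep cs w i = 0 := by rw [show ((i : ℕ) : ℤ) = 0 by omega, h0]
      rw [e1, e2, h3]
      omega
    · have e1 : signedFun i (i + 1) = i := by unfold signedFun; split_ifs <;> omega
      have e2 : signedFun i i = i + 1 := by unfold signedFun; split_ifs <;> omega
      rw [e1, e2]
      omega
  have h3 := length_mul_simple_lt_of_descent cs h2
  rw [cs.simple_mul_simple_cancel_right] at h3
  omega

/-- `x` is the end of a block of `K`: it is `n`, or a generator outside `K`. -/
def IsBoundary (K : Finset (Fin n)) (x : ℕ) : Prop := x ≤ n ∧ ∀ k ∈ K, (k : ℕ) ≠ x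

/-- Only the generator with index t can move a point greater than t to one that is at most t, and
this generator is not in K. -/
lemma IsBoundary.lt_signedRep {K : Finset (Fin n)} {t : ℕ} (ht : IsBoundary K t) {w : W}
    (hw : w ∈ parabolic cs K) {x : ℤ} (hx : (t : ℤ) < x) : (t : ℤ) < signedRep cs w x := by
  have hg : ∀ k ∈ K, ∀ y : ℤ, (t : ℤ) < y → (t : ℤ) < signedRep cs (cs.simple k) y := by
    intro k hk y hy
    have := ht.2 k hk
    rw [signedRep_simple, signedPerm_apply]
    have := signedFun_cases k y
    omega
  induction hw using Subgroup.closure_induction_left generalizing x with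
  | one => simpa using hx
  | mul_left y hy z hz ih =>
    obtain ⟨k, hk, rfl⟩ := hy
    rw [map_mul, Equiv.Perm.mul_apply]
    exact hg k hk _ (ih hx)
  | inv_mul_cancel y hy z hz ih =>
    obtain ⟨k, hk, rfl⟩ := hy
    rw [cs.inv_simple, map_mul, Equiv.Perm.mul_apply]
    exact hg k hk _ (ih hx)

lemma IsBoundary.signedRep_le {K : Finset (Fin n)} {t : ℕ} (ht : IsBoundary K t) {w : W}
    (hw : w ∈ parabolic cs K) {x : ℤ} (hx : x ≤ t) : signedRep cs w x ≤ t := by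
  by_contra! h
  have := ht.lt_signedRep cs (inv_mem hw) h
  rw [← Equiv.Perm.mul_apply, ← map_mul, inv_mul_cancel, map_one, Equiv.Perm.one_apply] at this
  omega

/-- `a < b` are consecutive ends of blocks of `K`. -/
structure IsBlock (K : Finset (Fin n)) (a b : ℕ) : Prop where
  lt : a < b
  left : IsBoundary K a
  right : IsBoundary K b
  mem : ∀ k : Fin n, a < k → (k : ℕ) < b → k ∈ K

/-- `b` is the first end of a block of `K`. -/
structure IsFirstBlock (K : Finset (Fin n)) (b : ℕ) : Prop where
  right : IsBoundary K b
  mem : ∀ k : Fin n, (k : ℕ) < b → k ∈ K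

/-- The longest element preserves the interval (a, b] and is strictly decreasing on it. Counting
steps from the left end bounds the values above, counting from the right end bounds them below, and
the bounds agree. -/
lemma IsBlock.signedRep_longest {K : Finset (Fin n)} {a b : ℕ} (h : IsBlock K a b) {x : ℤ}
    (hx : (a : ℤ) < x) (hx' : x ≤ b) : signedRep cs (longest cs K) x = a + b + 1 - x := by
  have hw := isLongest_longest cs K
  generalize longest cs K = w at hw
  have hstep : ∀ y : ℤ, (a : ℤ) < y → y < b → signedRep cs w (y + 1) < signedRep cs w y := by
    intro y h1 h2
    have hn := h.right.1
    have := hw.descent cs (h.mem ⟨y.toNat, by omega⟩ (by simp; omega) (by simp; omega))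
    have e : ((y.toNat : ℕ) : ℤ) = y := by omega
    simpa only [e] using this
  have hup : ∀ d : ℕ, (a : ℤ) + 1 + d ≤ b → signedRep cs w (a + 1 + d) ≤ b - d := by
    intro d hd
    induction d with
    | zero => simpa using h.right.signedRep_le cs hw.1 (by simpa using hd)
    | succ d ih =>
      have := hstep (a + 1 + d) (by omega) (by omega)
      have := ih (by omega)
      push_cast
      rw [← add_assoc]
      omega
  have hdown : ∀ d : ℕ, (a : ℤ) < b - d → (a : ℤ) + 1 + d ≤ signedRep cs w (b - d) := by
    intro d hd
    induction d with
    | zero =>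
      have := h.left.lt_signedRep cs hw.1 (x := b) (by simpa using hd)
      simp only [Nat.cast_zero, sub_zero]
      omega
    | succ d ih =>
      have h1 := hstep (b - d - 1) (by omega) (by omega)
      have := ih (by omega)
      rw [sub_add_cancel] at h1
      push_cast
      rw [← sub_sub]
      omega
  have h1 := hup (x - a - 1).toNat (by omega)
  have h2 := hdown (b - x).toNat (by omega)
  rw [show (a : ℤ) + 1 + (x - a - 1).toNat = x by omega] at h1
  rw [show (b : ℤ) - (b - x).toNat = x by omega] at h2
  omega

/-- The values decrease strictly from 0 at position 0. They cannot fall below -b, because the end b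
is respected and the action is odd. -/
lemma IsFirstBlock.signedRep_longest {K : Finset (Fin n)} {b : ℕ} (h : IsFirstBlock K b) {x : ℤ}
    (hx : 0 ≤ x) (hx' : x ≤ b) : signedRep cs (longest cs K) x = - x := by
  have hw := isLongest_longest cs K
  generalize longest cs K = w at hw
  have hstep : ∀ y : ℤ, 0 ≤ y → y < b → signedRep cs w (y + 1) < signedRep cs w y := by
    intro y h1 h2
    have hn := h.right.1
    have := hw.descent cs (h.mem ⟨y.toNat, by omega⟩ (by simp; omega))
    have e : ((y.toNat : ℕ) : ℤ) = y := by omega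
    simpa only [e] using this
  have hup : ∀ d : ℕ, (d : ℤ) ≤ b → signedRep cs w d ≤ - d := by
    intro d hd
    induction d with
    | zero => simp [signedRep_zero]
    | succ d ih =>
      have := hstep d (by omega) (by omega)
      have := ih (by omega)
      push_cast
      omega
  have hdown : ∀ d : ℕ, 0 ≤ (b : ℤ) - d → -(b : ℤ) + d ≤ signedRep cs w (b - d) := by
    intro d hd
    induction d with
    | zero =>
      have := h.right.signedRep_le cs hw.1 (x := -b) (by omega)
      rw [signedRep_neg] at this
      simp only [Nat.cast_zero, sub_zero]
      omega
    | succ d ih =>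
      have h1 := hstep (b - d - 1) (by omega) (by omega)
      have := ih (by omega)
      rw [sub_add_cancel] at h1
      push_cast
      rw [← sub_sub]
      omega
  have h1 := hup x.toNat (by omega)
  have h2 := hdown (b - x).toNat (by omega)
  rw [show (x.toNat : ℤ) = x by omega] at h1
  rw [show (b : ℤ) - (b - x).toNat = x by omega] at h2
  omega

lemma IsBlock.longest_mul_simple {K : Finset (Fin n)} {a b : ℕ} (h : IsBlock K a b) {r k : Fin n}
    (hr : a < r) (hr' : (r : ℕ) < b) (hk : (r : ℕ) + k = a + b) :
    longest cs K * cs.simple r = cs.simple k * longest cs K := by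
  apply mul_simple_eq_simple_mul
  have h1 := h.signedRep_longest cs (x := r) (by omega) (by omega)
  have h2 := h.signedRep_longest cs (x := r + 1) (by omega) (by omega)
  omega

lemma IsFirstBlock.longest_mul_simple {K : Finset (Fin n)} {b : ℕ} (h : IsFirstBlock K b)
    {r : Fin n} (hr : (r : ℕ) < b) :
    longest cs K * cs.simple r = cs.simple r * longest cs K := by
  apply mul_simple_eq_simple_mul
  have h1 := h.signedRep_longest cs (x := r) (by omega) (by omega)
  have h2 := h.signedRep_longest cs (x := r + 1) (by omega) (by omega)
  omega

lemma exists_block (K : Finset (Fin n)) {r : Fin n} (hr : r ∈ K) :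
    (∃ b, (r : ℕ) < b ∧ IsFirstBlock K b) ∨
      (∃ a b : ℕ, a < r ∧ (r : ℕ) < b ∧ IsBlock K a b) := by
  -- The number n is always an end, so a nearest end above r exists. Whether there is one below r
  -- decides if the block is the first.
  have hub : ∃ b : ℕ, (r : ℕ) < b ∧ IsBoundary K b := ⟨n, r.2, le_rfl, fun k _ => k.2.ne⟩
  classical
  obtain ⟨h1, h2⟩ := Nat.find_spec hub
  have h3 : ∀ k : Fin n, (r : ℕ) ≤ k → (k : ℕ) < Nat.find hub → k ∈ K := by
    intro k hk hk'
    by_contra hkK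
    rcases hk.eq_or_lt with h | h
    · exact hkK (Fin.ext h ▸ hr)
    · exact Nat.find_min hub hk' ⟨h, k.2.le, fun l hl hlk => hkK (Fin.ext hlk ▸ hl)⟩
  by_cases hlb : ∃ a : ℕ, a < r ∧ IsBoundary K a
  · right
    obtain ⟨a, ⟨ha1, ha2⟩, ha3⟩ : ∃ a : ℕ, (a < r ∧ IsBoundary K a) ∧
        ∀ a' : ℕ, a < a' → ¬ (a' < r ∧ IsBoundary K a') := by
      obtain ⟨a, ha⟩ := hlb
      refine ⟨Nat.findGreatest (fun a => a < r ∧ IsBoundary K a) r, ?_, ?_⟩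
      · exact Nat.findGreatest_spec (P := fun a => a < (r : ℕ) ∧ IsBoundary K a) ha.1.le ha
      · intro a' h4 h5
        exact Nat.findGreatest_is_greatest (P := fun a => a < (r : ℕ) ∧ IsBoundary K a) h4
          h5.1.le h5
    refine ⟨a, _, ha1, h1, ⟨by omega, ha2, h2, fun k hk hk' => ?_⟩⟩
    by_cases hkr : (r : ℕ) ≤ k
    · exact h3 k hkr hk'
    · by_contra hkK
      exact ha3 k hk ⟨by omega, k.2.le, fun l hl hlk => hkK (Fin.ext hlk ▸ hl)⟩
  · left
    refine ⟨_, h1, ⟨h2, fun k hk' => ?_⟩⟩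
    by_cases hkr : (r : ℕ) ≤ k
    · exact h3 k hkr hk'
    · by_contra hkK
      exact hlb ⟨k, by omega, k.2.le, fun l hl hlk => hkK (Fin.ext hlk ▸ hl)⟩

end Longest

/-! ### Conjugation of subsets by ω -/

section Conjugation

variable {n : ℕ} {W : Type*} [Group W] (cs : CoxeterSystem (typeB n) W)

/-- Here k is r itself in the first block and the reflected index a + b - r in a block from a to b.
-/
lemma exists_longest_mul_simple (K : Finset (Fin n)) {r : Fin n} (hr : r ∈ K) :
    ∃ k ∈ K, longest cs K * cs.simple r = cs.simple k * longest cs K ∧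
      longest cs K * cs.simple k = cs.simple r * longest cs K := by
  rcases exists_block K hr with ⟨b, hb, h⟩ | ⟨a, b, ha, hb, h⟩
  · exact ⟨r, hr, h.longest_mul_simple cs hb, h.longest_mul_simple cs hb⟩
  · have hn := h.right.1
    refine ⟨⟨a + b - r, by omega⟩, h.mem _ (by simp; omega) (by simp; omega),
      h.longest_mul_simple cs ha hb (by simp; omega),
      h.longest_mul_simple cs (by simp; omega) (by simp; omega) (by simp; omega)⟩

lemma simple_mul_omega {J : Finset (Fin n)} {s r k t : Fin n}
    (h₁ : longest cs J * cs.simple k = cs.simple r * longest cs J)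
    (h₂ : longest cs (insert s J) * cs.simple t = cs.simple k * longest cs (insert s J)) :
    cs.simple r * omega cs J s = omega cs J s * cs.simple t := by
  rw [omega, ← mul_assoc, ← h₁, mul_assoc, mul_assoc, h₂]

lemma exists_simple_mul_omega (J : Finset (Fin n)) (s : Fin n) {r : Fin n} (hr : r ∈ J) :
    ∃ t, cs.simple r * omega cs J s = omega cs J s * cs.simple t := by
  obtain ⟨k, hk, -, h1⟩ := exists_longest_mul_simple cs J hr
  obtain ⟨t, -, -, h2⟩ := exists_longest_mul_simple cs (insert s J) (Finset.mem_insert_of_mem hk)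
  exact ⟨t, simple_mul_omega cs h1 h2⟩

lemma mem_conjSubset {J : Finset (Fin n)} {w : W} {t : Fin n} : t ∈ conjSubset cs w J ↔
    ∃ r ∈ J, cs.simple r * w = w * cs.simple t := by
  simp only [conjSubset, Finset.mem_filter, Finset.mem_univ, true_and]
  refine exists_congr fun r => and_congr_right fun _ => ?_
  rw [mul_assoc, eq_inv_mul_iff_mul_eq, eq_comm]

/-- Conjugation by `omega cs J₀ s` permutes the simple reflections in `J₀` as an injective map
does. -/
lemma exists_conj_map (J₀ : Finset (Fin n)) (s : Fin n) : ∃ f : Fin n → Fin n,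
    Set.InjOn f J₀ ∧ (∀ r ∈ J₀, cs.simple r * omega cs J₀ s = omega cs J₀ s * cs.simple (f r)) ∧
    ∀ J ⊆ J₀, conjSubset cs (omega cs J₀ s) J = J.image f := by
  choose! f hf using fun r hr => exists_simple_mul_omega cs J₀ s (r := r) hr
  refine ⟨f, fun r hr r' hr' h => ?_, hf, fun J hJ => ?_⟩
  · have h1 := hf r hr
    rw [h, ← hf r' hr'] at h1
    exact simple_injective cs (mul_right_cancel h1)
  · ext t
    simp only [mem_conjSubset, Finset.mem_image]
    refine exists_congr fun r => and_congr_right fun hr => ?_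
    rw [hf r (hJ hr), mul_right_inj, (simple_injective cs).eq_iff]

lemma IsSubsetChain.subset {J K : Finset (Fin n)} {a : List (Finset (Fin n))}
    (h : IsSubsetChain (J :: a)) (hK : K ∈ J :: a) : K ⊆ J := by
  have h' := h.2
  clear h
  induction a generalizing J with
  | nil => simp only [List.mem_singleton] at hK; rw [hK]
  | cons L a ih =>
    rw [List.isChain_cons_cons] at h'
    rcases List.mem_cons.1 hK with rfl | hK
    · rfl
    · exact (ih hK h'.2).trans h'.1.1

lemma isSubsetChain_chainAct {J₀ : Finset (Fin n)} {a : List (Finset (Fin n))}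
    (h : IsSubsetChain (J₀ :: a)) (s : Fin n) : IsSubsetChain (chainAct cs (J₀ :: a) s) := by
  obtain ⟨f, hf, -, hJ⟩ := exists_conj_map cs J₀ s
  refine ⟨by simp [chainAct], ?_⟩
  have key : ∀ (b : List (Finset (Fin n))) (J : Finset (Fin n)), J ⊆ J₀ →
      (J :: b).IsChain (fun J K => K ⊆ J ∧ (J \ K).card = 1) →
      ((J :: b).map (conjSubset cs (omega cs J₀ s))).IsChain
        (fun J K => K ⊆ J ∧ (J \ K).card = 1) := by
    intro b
    induction b with
    | nil => simp
    | cons K b ih =>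
      intro J hJ₀ hc
      rw [List.isChain_cons_cons] at hc
      have hK := hc.1.1.trans hJ₀
      have := ih K hK hc.2
      rw [List.map_cons, List.map_cons] at *
      rw [List.isChain_cons_cons]
      refine ⟨?_, this⟩
      rw [hJ J hJ₀, hJ K hK]
      refine ⟨Finset.image_subset_image hc.1.1, ?_⟩
      rw [← Finset.image_sdiff_of_injOn (hf.mono (by simpa using hJ₀)) hc.1.1,
        Finset.card_image_of_injOn (hf.mono
          (Finset.coe_subset.2 (Finset.sdiff_subset.trans hJ₀))), hc.1.2]
  exact key a J₀ le_rfl h.2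

/-- By definition `conjSubset` keeps only those elements of the conjugate that are generators. For
subsets of J₀ nothing is lost: the conjugate consists of generators. -/
lemma simple_image_conjSubset {J₀ J : Finset (Fin n)} (hJ : J ⊆ J₀) (s : Fin n) :
    cs.simple '' (conjSubset cs (omega cs J₀ s) J : Set (Fin n)) =
      (fun x => (omega cs J₀ s)⁻¹ * x * omega cs J₀ s) '' (cs.simple '' (J : Set (Fin n))) := by
  obtain ⟨f, -, hf, hc⟩ := exists_conj_map cs J₀ s
  rw [hc J hJ, Finset.coe_image, Set.image_image, Set.image_image]
  refine Set.image_congr fun r hr => ?_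
  rw [mul_assoc, hf r (hJ hr), inv_mul_cancel_left]

/-- Here φ describes the conjugation on indices and y is the position that ends up at x. Positions
outside J₀ are allowed as well; then x must avoid the image of φ. -/
lemma isBoundary_conjSubset_iff {J₀ J : Finset (Fin n)} (hJ : J ⊆ J₀) {s : Fin n} {φ : ℕ → ℕ}
    (hφ : ∀ r ∈ J₀, ∀ t : Fin n, φ r = t →
      cs.simple r * omega cs J₀ s = omega cs J₀ s * cs.simple t) (hφn : ∀ r ∈ J₀, φ r < n)
    {x y : ℕ} (hxy : x ≤ n ↔ y ≤ n) (hr : ∀ r ∈ J₀, φ r = x ↔ r = y) :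
    IsBoundary (conjSubset cs (omega cs J₀ s) J) x ↔ IsBoundary J y := by
  refine and_congr hxy ⟨fun h k hk hky => ?_, fun h t ht htx => ?_⟩
  · have hkx := (hr k (hJ hk)).2 hky
    exact h ⟨φ k, hφn k (hJ hk)⟩ ((mem_conjSubset cs).2 ⟨k, hk, hφ k (hJ hk) _ rfl⟩) hkx
  · obtain ⟨r, hrJ, hrt⟩ := (mem_conjSubset cs).1 ht
    have h1 := hφ r (hJ hrJ) ⟨φ r, hφn r (hJ hrJ)⟩ rfl
    rw [hrt, mul_right_inj, (simple_injective cs).eq_iff] at h1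
    exact h r hrJ ((hr r (hJ hrJ)).1 (by rw [← htx, h1]))

lemma IsBoundary.insert {K : Finset (Fin n)} {x : ℕ} (h : IsBoundary K x) {s : Fin n}
    (hs : (s : ℕ) ≠ x) : IsBoundary (insert s K) x :=
  ⟨h.1, fun k hk => by
    rcases Finset.mem_insert.1 hk with rfl | hk
    · exact hs
    · exact h.2 k hk⟩

/-- The hypothesis places another end strictly between s and r whenever s is an end. The block of r
is then the same for J and for J ∪ {s}, and the two longest elements have cancelling effects on it.
-/
lemma simple_mul_omega_of_fixed {J : Finset (Fin n)} {s r : Fin n} (hr : r ∈ J)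
    (h : ∀ x, IsBoundary J x → x = s → (∃ b, b < x ∧ IsBoundary J b ∧ (r : ℕ) < b) ∨
      (∃ a, x < a ∧ IsBoundary J a ∧ a < r)) :
    cs.simple r * omega cs J s = omega cs J s * cs.simple r := by
  rcases exists_block J hr with ⟨b, hb, hB⟩ | ⟨a, b, ha, hb, hB⟩
  · have hs : (s : ℕ) ≠ b := by
      intro hsb
      rcases h b hB.right hsb.symm with ⟨c, h1, h2, h3⟩ | ⟨c, h1, h2, h3⟩
      · have := h2.1; have := hB.right.1
        exact h2.2 ⟨c, by omega⟩ (hB.mem _ h1) rfl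
      · omega
    have hB' : IsFirstBlock (insert s J) b := ⟨hB.right.insert hs, fun k hk =>
      Finset.mem_insert_of_mem (hB.mem k hk)⟩
    exact simple_mul_omega cs (hB.longest_mul_simple cs hb) (hB'.longest_mul_simple cs hb)
  · have hn := hB.right.1
    have hs : (s : ℕ) ≠ b := by
      intro hsb
      rcases h b hB.right hsb.symm with ⟨c, h1, h2, h3⟩ | ⟨c, h1, h2, h3⟩
      · exact h2.2 ⟨c, by omega⟩ (hB.mem _ (by simp; omega) h1) rfl
      · omega
    have hs' : (s : ℕ) ≠ a := by
      intro hsa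
      rcases h a hB.left hsa.symm with ⟨c, h1, h2, h3⟩ | ⟨c, h1, h2, h3⟩
      · omega
      · exact h2.2 ⟨c, by omega⟩ (hB.mem _ h1 (by simp; omega)) rfl
    have hB' : IsBlock (insert s J) a b := ⟨hB.lt, hB.left.insert hs', hB.right.insert hs,
      fun k hk hk' => Finset.mem_insert_of_mem (hB.mem k hk hk')⟩
    exact simple_mul_omega cs (k := ⟨a + b - r, by omega⟩)
      (hB.longest_mul_simple cs (by simp; omega) (by simp; omega) (by simp; omega))
      (hB'.longest_mul_simple cs ha hb (by simp; omega))

/-- The first generator outside `J₀` acts on the subsets of `J₀` by reversing the block that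
follows it. -/
lemma isBoundary_conjSubset_reverse {J₀ J : Finset (Fin n)} (hJ : J ⊆ J₀) {a c : ℕ}
    (h₁ : IsFirstBlock J₀ a) (h₂ : IsBlock J₀ a c) {s : Fin n} (hs : (s : ℕ) = a) (x : ℕ) :
    IsBoundary (conjSubset cs (omega cs J₀ s) J) x ↔
      IsBoundary J (if a < x ∧ x < c then a + c - x else x) := by
  have hcn := h₂.right.1
  have hins : IsFirstBlock (insert s J₀) c := by
    refine ⟨h₂.right.insert (by have := h₂.lt; omega), fun k hk => ?_⟩
    rcases lt_trichotomy (k : ℕ) a with h | h | h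
    · exact Finset.mem_insert_of_mem (h₁.mem k h)
    · exact Finset.mem_insert.2 (Or.inl (Fin.ext (by omega)))
    · exact Finset.mem_insert_of_mem (h₂.mem k h hk)
  have hac := h₂.lt
  refine isBoundary_conjSubset_iff cs hJ (φ := fun x => if a < x ∧ x < c then a + c - x else x)
    ?_ ?_ ?_ ?_
  · intro r hr t ht
    have ha' := h₂.left.2 r hr
    have hc' := h₂.right.2 r hr
    by_cases h : a < r ∧ (r : ℕ) < c
    · rw [if_pos h] at ht
      -- The reversal by w_{J₀} survives, since adding s merges this block into the first block, on
      -- whose generators the longest element acts trivially.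
      exact simple_mul_omega cs (h₂.longest_mul_simple cs (by omega) (by omega) (by omega))
        (hins.longest_mul_simple cs (by omega))
    · rw [if_neg h] at ht
      obtain rfl := Fin.ext ht
      rcases lt_trichotomy (r : ℕ) a with h' | h' | h'
      · exact simple_mul_omega cs (h₁.longest_mul_simple cs h')
          (hins.longest_mul_simple cs (by omega))
      · omega
      · refine simple_mul_omega_of_fixed cs hr fun x _ hx => Or.inr ⟨c, by omega, h₂.right, ?_⟩
        omega
  · intro r hr
    have := r.2
    split_ifs <;> omega
  · split_ifs <;> omega
  · intro r hr
    split_ifs <;> omega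

/-- A generator outside `J₀` between two blocks acts on the subsets of `J₀` by exchanging these
two blocks. -/
lemma isBoundary_conjSubset_swap {J₀ J : Finset (Fin n)} (hJ : J ⊆ J₀) {a b c : ℕ}
    (h₁ : IsBlock J₀ a b) (h₂ : IsBlock J₀ b c) {s : Fin n} (hs : (s : ℕ) = b) (x : ℕ) :
    IsBoundary (conjSubset cs (omega cs J₀ s) J) x ↔
      IsBoundary J (if a < x ∧ x < c then
        (if x < a + c - b then x + b - a else if x = a + c - b then b else x + b - c) else x) := by
  have hcn := h₂.right.1
  have hab := h₁.lt
  have hac := h₂.lt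
  have hins : IsBlock (insert s J₀) a c := by
    refine ⟨by omega, h₁.left.insert (by omega), h₂.right.insert (by omega), fun k hk hk' => ?_⟩
    rcases lt_trichotomy (k : ℕ) b with h | h | h
    · exact Finset.mem_insert_of_mem (h₁.mem k hk h)
    · exact Finset.mem_insert.2 (Or.inl (Fin.ext (by omega)))
    · exact Finset.mem_insert_of_mem (h₂.mem k h hk')
  -- Two reversals compose to a translation: r ↦ a + b - r ↦ r + c - b on the left block and r ↦ b +
  -- c - r ↦ r + a - b on the right one. The new separator is a + c - b.
  refine isBoundary_conjSubset_iff cs hJ (φ := fun x => if a < x ∧ x < b then x + c - b else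
    if b < x ∧ x < c then x + a - b else x) ?_ ?_ ?_ ?_
  · intro r hr t ht
    have ha' := h₁.left.2 r hr
    have hb' := h₁.right.2 r hr
    have hc' := h₂.right.2 r hr
    by_cases h : a < r ∧ (r : ℕ) < b
    · rw [if_pos h] at ht
      exact simple_mul_omega cs (k := ⟨a + b - r, by omega⟩)
        (h₁.longest_mul_simple cs (by simp; omega) (by simp; omega) (by simp; omega))
        (hins.longest_mul_simple cs (by omega) (by omega) (by simp; omega))
    by_cases h' : b < r ∧ (r : ℕ) < c
    · rw [if_neg h, if_pos h'] at ht
      exact simple_mul_omega cs (k := ⟨b + c - r, by omega⟩)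
        (h₂.longest_mul_simple cs (by simp; omega) (by simp; omega) (by simp; omega))
        (hins.longest_mul_simple cs (by omega) (by omega) (by simp; omega))
    rw [if_neg h, if_neg h'] at ht
    obtain rfl := Fin.ext ht
    refine simple_mul_omega_of_fixed cs hr fun x _ hx => ?_
    by_cases h'' : (r : ℕ) < a
    · exact Or.inl ⟨a, by omega, h₁.left, h''⟩
    · exact Or.inr ⟨c, by omega, h₂.right, by omega⟩
  · intro r hr
    have := r.2
    split_ifs <;> omega
  · split_ifs <;> omega
  · intro r hr
    have ha' := h₁.left.2 r hr
    have hb' := h₁.right.2 r hr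
    have hc' := h₂.right.2 r hr
    split_ifs <;> omega

end Conjugation

/-! ### Compositions and their partial sums -/

/-- `x` is the sum of an initial segment of `c`. -/
def IsPartialSum (c : List ℕ) (x : ℕ) : Prop := ∃ p, p <+: c ∧ p.sum = x

lemma isPartialSum_nil {x : ℕ} : IsPartialSum [] x ↔ x = 0 := by
  simp [IsPartialSum, List.prefix_nil, eq_comm]

lemma isPartialSum_zero (c : List ℕ) : IsPartialSum c 0 := ⟨[], List.nil_prefix, rfl⟩

lemma isPartialSum_sum (c : List ℕ) : IsPartialSum c c.sum := ⟨c, List.prefix_rfl, rfl⟩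

lemma IsPartialSum.le {c : List ℕ} {x : ℕ} (h : IsPartialSum c x) : x ≤ c.sum := by
  obtain ⟨p, ⟨q, rfl⟩, rfl⟩ := h
  simp

lemma isPartialSum_cons {d : ℕ} {c : List ℕ} {x : ℕ} :
    IsPartialSum (d :: c) x ↔ x = 0 ∨ ∃ y, IsPartialSum c y ∧ x = d + y := by
  constructor
  · rintro ⟨p, hp, rfl⟩
    rcases List.prefix_cons_iff.1 hp with rfl | ⟨t, rfl, ht⟩
    · simp
    · exact Or.inr ⟨t.sum, ⟨t, ht, rfl⟩, by simp⟩
  · rintro (rfl | ⟨_, ⟨p, hp, rfl⟩, rfl⟩)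
    · exact isPartialSum_zero _
    · exact ⟨d :: p, List.cons_prefix_cons.2 ⟨rfl, hp⟩, by simp⟩

lemma isPartialSum_append {A B : List ℕ} {x : ℕ} : IsPartialSum (A ++ B) x ↔
    if x ≤ A.sum then IsPartialSum A x else IsPartialSum B (x - A.sum) := by
  induction A generalizing x with
  | nil =>
    rcases Nat.eq_zero_or_pos x with rfl | h
    · simp [isPartialSum_zero]
    · simp [h.ne']
  | cons d A ih =>
    rw [List.cons_append, isPartialSum_cons]
    simp only [ih, isPartialSum_cons, List.sum_cons]
    constructor
    · rintro (rfl | ⟨y, h, rfl⟩)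
      · simp
      · split_ifs at h ⊢ <;> first | omega | skip
        · exact Or.inr ⟨y, h, rfl⟩
        · rwa [Nat.add_sub_add_left]
    · intro h
      split_ifs at h with h'
      · rcases h with rfl | ⟨y, h, rfl⟩
        · exact Or.inl rfl
        · exact Or.inr ⟨y, by rwa [if_pos (by omega)], rfl⟩
      · refine Or.inr ⟨x - d, ?_, by omega⟩
        rw [if_neg (by omega)]
        rwa [Nat.sub_sub]

lemma isPartialSum_reverse {B : List ℕ} {x : ℕ} (hx : x ≤ B.sum) :
    IsPartialSum B.reverse x ↔ IsPartialSum B (B.sum - x) := by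
  have key : ∀ (B : List ℕ) (x : ℕ), x ≤ B.sum → IsPartialSum B.reverse x →
      IsPartialSum B (B.sum - x) := by
    rintro B x hx ⟨p, ⟨q, hq⟩, rfl⟩
    have : B = q.reverse ++ p.reverse := by
      rw [← List.reverse_append, hq, List.reverse_reverse]
    exact ⟨q.reverse, ⟨p.reverse, this.symm⟩, by simp [this]⟩
  refine ⟨key B x hx, fun h => ?_⟩
  have := key B.reverse (B.sum - x) (by simp) (by rwa [List.reverse_reverse])
  rwa [List.sum_reverse, Nat.sub_sub_self hx] at this

lemma isPartialSum_iff_take {c : List ℕ} {x : ℕ} :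
    IsPartialSum c x ↔ ∃ i ≤ c.length, x = (c.take i).sum := by
  constructor
  · rintro ⟨p, hp, rfl⟩
    exact ⟨p.length, hp.length_le, congrArg List.sum (List.prefix_iff_eq_take.1 hp)⟩
  · rintro ⟨i, -, rfl⟩
    exact ⟨c.take i, List.take_prefix _ _, rfl⟩

/-- This allows compositions to be identified by their partial sums; positivity makes the first part
the least nonzero partial sum. -/
lemma eq_of_isPartialSum {c d : List ℕ} (hc : ∀ x ∈ c, 0 < x) (hd : ∀ x ∈ d, 0 < x)
    (h : ∀ x, IsPartialSum c x ↔ IsPartialSum d x) : c = d := by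
  induction c generalizing d with
  | nil =>
    cases d with
    | nil => rfl
    | cons y d =>
      have h1 := (h y).2 (isPartialSum_cons.2 (Or.inr ⟨0, isPartialSum_zero _, rfl⟩))
      have := hd y (by simp)
      rw [isPartialSum_nil] at h1
      omega
  | cons x c ih =>
    have hx := hc x (by simp)
    cases d with
    | nil =>
      have h1 := (h x).1 (isPartialSum_cons.2 (Or.inr ⟨0, isPartialSum_zero _, rfl⟩))
      rw [isPartialSum_nil] at h1
      omega
    | cons y d =>
      have hy := hd y (by simp)
      have h1 := (h x).1 (isPartialSum_cons.2 (Or.inr ⟨0, isPartialSum_zero _, rfl⟩))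
      have h2 := (h y).2 (isPartialSum_cons.2 (Or.inr ⟨0, isPartialSum_zero _, rfl⟩))
      rw [isPartialSum_cons] at h1 h2
      have hxy : x = y := by
        rcases h1 with h1 | ⟨_, -, h1⟩ <;> rcases h2 with h2 | ⟨_, -, h2⟩ <;> omega
      subst hxy
      rw [ih (d := d) (fun z hz => hc z (by simp [hz])) (fun z hz => hd z (by simp [hz])) fun z => ?_]
      have h3 := h (x + z)
      simp only [isPartialSum_cons, Nat.add_eq_zero_iff, hx.ne', false_and, false_or,
        Nat.add_left_cancel_iff] at h3
      simpa using h3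

/-- The differences telescope. The starting value s is arbitrary for the sake of the induction. -/
lemma zipWith_sub_spec (t : List ℕ) (s N : ℕ) (h : (s :: t).SortedLT) (hN : ∀ x ∈ s :: t, x < N) :
    let D := List.zipWith (fun x y => y - x) (s :: t) (t ++ [N])
    (∀ x ∈ D, 0 < x) ∧ s + D.sum = N ∧
      ∀ x, IsPartialSum D x ↔ x = 0 ∨ s + x ∈ t ∨ s + x = N := by
  induction t generalizing s with
  | nil =>
    have := hN s (by simp)
    simp only [List.nil_append, List.zipWith_cons_cons, List.zipWith_nil_left, List.mem_singleton,
      forall_eq, List.sum_singleton, isPartialSum_cons, isPartialSum_nil, List.not_mem_nil]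
    refine ⟨by omega, by omega, fun x => ?_⟩
    simp only [exists_eq_left, false_or]
    omega
  | cons u t ih =>
    have hs := h.pairwise
    rw [List.pairwise_cons] at hs
    have hsu := hs.1 u (by simp)
    have huN := hN u (by simp)
    obtain ⟨h1, h2, h3⟩ := ih u hs.2.sortedLT (fun x hx => hN x (List.mem_cons_of_mem _ hx))
    simp only [List.cons_append, List.zipWith_cons_cons] at h1 h2 h3 ⊢
    refine ⟨?_, ?_, fun x => ?_⟩
    · intro x hx
      rcases List.mem_cons.1 hx with rfl | hx
      · omega
      · exact h1 x hx
    · rw [List.sum_cons]; omega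
    · simp only [isPartialSum_cons, h3, List.mem_cons]
      constructor
      · rintro (h | ⟨y, h | h | h, rfl⟩)
        · exact Or.inl h
        · exact Or.inr (Or.inl (Or.inl (by omega)))
        · exact Or.inr (Or.inl (Or.inr (by rwa [show s + (u - s + y) = u + y by omega])))
        · exact Or.inr (Or.inr (by omega))
      · rintro (h | (h | h) | h)
        · exact Or.inl h
        · exact Or.inr ⟨0, Or.inl rfl, by omega⟩
        · have : u < s + x := (List.pairwise_cons.1 hs.2).1 _ h
          exact Or.inr ⟨s + x - u, Or.inr (Or.inl (by rwa [show u + (s + x - u) = s + x by omega])),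
            by omega⟩
        · exact Or.inr ⟨s + x - u, Or.inr (Or.inr (by omega)), by omega⟩

/-! ### Compositions of subsets and of their conjugates -/

section Composition

variable {n : ℕ}

/-- The dictionary between compositions and ends of blocks. The shift by one arises because the
element x of `Fin n` stands for the generator x + 1. -/
lemma composition_spec (J : Finset (Fin n)) : (∀ x ∈ composition J, 0 < x) ∧
    (composition J).sum = n + 1 ∧
    ∀ x, IsPartialSum (composition J) (x + 1) ↔ IsBoundary J x := by
  obtain ⟨h1, h2, h3⟩ := zipWith_sub_spec
    ((Jᶜ.image (fun i : Fin n => (i : ℕ) + 1)).sort (· ≤ ·)) 0 (n + 1) (by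
      refine List.Pairwise.sortedLT (List.pairwise_cons.2 ⟨?_, (Finset.sortedLT_sort _).pairwise⟩)
      intro x hx
      simp only [Finset.mem_sort, Finset.mem_image] at hx
      omega) (by
      intro x hx
      simp only [List.mem_cons, Finset.mem_sort, Finset.mem_image] at hx
      rcases hx with rfl | ⟨i, -, rfl⟩ <;> omega)
  refine ⟨h1, (zero_add _).symm.trans h2, fun x => ?_⟩
  rw [composition, h3]
  simp only [zero_add, Finset.mem_sort, Finset.mem_image, Finset.mem_compl, IsBoundary]
  constructor
  · rintro (h | ⟨i, hi, h⟩ | h)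
    · omega
    · refine ⟨by omega, fun k hk hkx => hi ?_⟩
      rwa [show i = k from Fin.ext (by omega)]
    · exact ⟨by omega, fun k _ => by omega⟩
  · rintro ⟨h, h'⟩
    rcases h.eq_or_lt with h | h
    · exact Or.inr (Or.inr (by omega))
    · exact Or.inr (Or.inl ⟨⟨x, h⟩, fun hx => h' _ hx rfl, rfl⟩)

lemma composition_eq {J : Finset (Fin n)} {c : List ℕ} (hc : ∀ x ∈ c, 0 < x)
    (h : ∀ x, IsPartialSum c (x + 1) ↔ IsBoundary J x) : composition J = c := by
  obtain ⟨h1, -, h3⟩ := composition_spec J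
  refine eq_of_isPartialSum h1 hc fun x => ?_
  cases x with
  | zero => simp [isPartialSum_zero]
  | succ x => rw [h3, h]

lemma mem_of_not_isPartialSum {J : Finset (Fin n)} {k : Fin n}
    (h : ¬ IsPartialSum (composition J) (k + 1)) : k ∈ J := by
  by_contra hk
  refine h (((composition_spec J).2.2 k).2 ⟨k.2.le, fun l hl hlk => hk ?_⟩)
  rwa [← Fin.ext hlk]

lemma isFirstBlock_of_composition {J : Finset (Fin n)} {x : ℕ} {r : List ℕ}
    (h : composition J = x :: r) : IsFirstBlock J (x - 1) := by
  have hx : 0 < x := (composition_spec J).1 x (by simp [h])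
  refine ⟨((composition_spec J).2.2 _).1 ?_, fun k hk => mem_of_not_isPartialSum ?_⟩
  · rw [Nat.sub_add_cancel hx, h, isPartialSum_cons]
    exact Or.inr ⟨0, isPartialSum_zero _, rfl⟩
  · rw [h, isPartialSum_cons]
    rintro (h | ⟨y, -, h⟩) <;> omega

lemma sum_pos_of_composition {J : Finset (Fin n)} {p r : List ℕ} (h : composition J = p ++ r)
    (hp : p ≠ []) : 0 < p.sum := by
  obtain ⟨a, p, rfl⟩ := List.exists_cons_of_ne_nil hp
  have : 0 < a := (composition_spec J).1 a (by simp [h])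
  simp only [List.sum_cons]
  omega

lemma isBlock_of_composition {J : Finset (Fin n)} {p r : List ℕ} {y : ℕ}
    (h : composition J = p ++ y :: r) (hp : p ≠ []) :
    IsBlock J (p.sum - 1) (p.sum + y - 1) := by
  have hy : 0 < y := (composition_spec J).1 y (by simp [h])
  have hp0 := sum_pos_of_composition h hp
  refine ⟨by omega, ((composition_spec J).2.2 _).1 ?_, ((composition_spec J).2.2 _).1 ?_,
    fun k hk hk' => mem_of_not_isPartialSum ?_⟩
  · rw [Nat.sub_add_cancel hp0, h]
    exact ⟨p, List.prefix_append _ _, rfl⟩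
  · rw [Nat.sub_add_cancel (by omega), h]
    exact ⟨p ++ [y], ⟨r, by simp⟩, by simp⟩
  · rw [h, isPartialSum_append, if_neg (by omega), isPartialSum_cons]
    rintro (h | ⟨y, -, h⟩) <;> omega

/-- The elements of the complement are the partial sums of the composition. -/
lemma enum_compl_add_one {J : Finset (Fin n)} {j : ℕ} {t : Fin j → Fin n} (ht : StrictMono t)
    (htJ : ∀ s, s ∈ Set.range t ↔ s ∉ J) (hj : (composition J).length = j + 1) (i : Fin j) :
    (t i : ℕ) + 1 = ((composition J).take (i + 1)).sum := by
  obtain ⟨h1, h2, h3⟩ := composition_spec J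
  generalize composition J = q at *
  have hmono : ∀ a b : ℕ, a < b → b ≤ j + 1 → (q.take a).sum < (q.take b).sum := by
    intro a b hab hb
    obtain ⟨d, rfl⟩ : ∃ d, b = a + 1 + d := ⟨b - (a + 1), by omega⟩
    have h4 : a < q.length := by omega
    have h5 := h1 _ (List.getElem_mem h4)
    have h6 : (q.take (a + 1)).sum = (q.take a).sum + q[a] := by
      rw [List.take_add_one, List.getElem?_eq_getElem h4, List.sum_append, Option.toList_some,
        List.sum_singleton]
    have h7 : (q.take (a + 1 + d)).sum = (q.take (a + 1)).sum + ((q.drop (a + 1)).take d).sum := by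
      rw [List.take_add, List.sum_append]
    omega
  have hpos : ∀ i : Fin j, 0 < (q.take (i + 1)).sum := fun i => by
    have := hmono 0 (i + 1) (by omega) (by omega)
    omega
  have hu : StrictMono (fun i : Fin j => (q.take (i + 1)).sum) := fun a b hab =>
    hmono _ _ (by have : (a : ℕ) < b := hab; omega) (by omega)
  have ht' : StrictMono (fun i : Fin j => (t i : ℕ) + 1) := fun a b hab => by
    have : (t a : ℕ) < t b := ht hab
    simpa using this
  -- Strictly increasing enumerations of the same set coincide, so it suffices to compare the
  -- ranges.
  have hrange : Set.range (fun i : Fin j => (t i : ℕ) + 1) =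
      Set.range (fun i : Fin j => (q.take (i + 1)).sum) := by
    ext x
    constructor
    · rintro ⟨i, rfl⟩
      have hb : IsBoundary J (t i) := ⟨(t i).2.le, fun k hk hkt =>
        (htJ (t i)).1 ⟨i, rfl⟩ (by rwa [← Fin.ext hkt])⟩
      obtain ⟨l, hl, h⟩ := isPartialSum_iff_take.1 ((h3 _).2 hb)
      have hl0 : l ≠ 0 := by rintro rfl; simp at h
      have hlj : l ≠ j + 1 := by
        rintro rfl
        rw [← hj, List.take_length, h2] at h
        have := (t i).2
        omega
      exact ⟨⟨l - 1, by omega⟩, by simp only [Nat.sub_add_cancel (Nat.pos_of_ne_zero hl0), h]⟩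
    · rintro ⟨i, rfl⟩
      have h4 := hpos i
      have h5 := hmono (i + 1) (j + 1) (by omega) le_rfl
      rw [← hj, List.take_length, h2] at h5
      have hb := (h3 ((q.take (i + 1)).sum - 1)).1
        (isPartialSum_iff_take.2 ⟨i + 1, by omega, by omega⟩)
      obtain ⟨l, hl⟩ := (htJ ⟨(q.take (i + 1)).sum - 1, by omega⟩).2 fun h => hb.2 _ h rfl
      refine ⟨l, ?_⟩
      simp only [hl]
      omega
  exact congrFun ((ht'.range_inj hu).1 hrange) i

variable {W : Type*} [Group W] (cs : CoxeterSystem (typeB n) W)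

/-- The segments A, B and C refine the first part, the second part and the remaining parts of the
composition of the larger set J₀. The cuts inside B are reflected and all others stay. -/
lemma composition_conjSubset_reverse {J₀ J : Finset (Fin n)} (hJ : J ⊆ J₀) {x y : ℕ} {r : List ℕ}
    (h₀ : composition J₀ = x :: y :: r) {s : Fin n} (hs : (s : ℕ) + 1 = x) {A B C : List ℕ}
    (h : composition J = A ++ B ++ C) (hA : A.sum = x) (hB : B.sum = y) :
    composition (conjSubset cs (omega cs J₀ s) J) = A ++ B.reverse ++ C := by
  obtain ⟨h1, -, h3⟩ := composition_spec J
  have b1 := isFirstBlock_of_composition h₀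
  have b2 := isBlock_of_composition (p := [x]) (y := y) (r := r) h₀ (by simp)
  rw [List.sum_singleton] at b2
  refine composition_eq (fun z hz => h1 z ?_) fun z => ?_
  · rw [h]; simpa using hz
  · rw [isBoundary_conjSubset_reverse cs hJ b1 b2 (by omega), ← h3, h]
    simp only [List.append_assoc, isPartialSum_append, List.sum_reverse, hA, hB]
    by_cases hz : x - 1 < z ∧ z < x + y - 1
    · rw [if_pos hz, if_neg (by omega), if_pos (by omega), if_neg (by omega), if_pos (by omega),
        isPartialSum_reverse (by omega), hB]
      rw [show y - (z + 1 - x) = x - 1 + (x + y - 1) - z + 1 - x by omega]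
    · rw [if_neg hz]
      by_cases hz1 : z + 1 ≤ x
      · rw [if_pos hz1, if_pos hz1]
      · rw [if_neg hz1, if_neg hz1]
        by_cases hz2 : z + 1 - x ≤ y
        · have e : z + 1 - x = y := by omega
          rw [if_pos hz2, if_pos hz2, e]
          have e1 := isPartialSum_sum B
          have e2 := isPartialSum_sum B.reverse
          rw [List.sum_reverse, hB] at e2
          rw [hB] at e1
          exact iff_of_true e2 e1
        · rw [if_neg hz2, if_neg hz2]

/-- The segments A and B refine the two exchanged parts of the composition of J₀; their inner cuts
are translated. The nonempty prefix p keeps both parts away from the first block, where signs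
interfere. -/
lemma composition_conjSubset_swap {J₀ J : Finset (Fin n)} (hJ : J ⊆ J₀) {x y : ℕ} {p r : List ℕ}
    (h₀ : composition J₀ = p ++ x :: y :: r) (hp : p ≠ []) {s : Fin n}
    (hs : (s : ℕ) + 1 = p.sum + x) {P A B C : List ℕ}
    (h : composition J = P ++ A ++ B ++ C) (hP : P.sum = p.sum) (hA : A.sum = x) (hB : B.sum = y) :
    composition (conjSubset cs (omega cs J₀ s) J) = P ++ B ++ A ++ C := by
  obtain ⟨h1, -, h3⟩ := composition_spec J
  have b1 := isBlock_of_composition (p := p) (y := x) (r := y :: r) h₀ hp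
  have b2 := isBlock_of_composition (p := p ++ [x]) (y := y) (r := r) (by simpa using h₀) (by simp)
  rw [List.sum_append, List.sum_singleton] at b2
  have hp0 := sum_pos_of_composition h₀ hp
  have l1 := b1.lt
  have l2 := b2.lt
  refine composition_eq (fun z hz => h1 z ?_) fun z => ?_
  · rw [h]; simp only [List.mem_append] at hz ⊢; tauto
  · rw [isBoundary_conjSubset_swap cs hJ b1 b2 (by omega), ← h3, h]
    have hA0 := isPartialSum_sum A
    have hB0 := isPartialSum_sum B
    rw [hA] at hA0
    rw [hB] at hB0
    by_cases hz : p.sum - 1 < z ∧ z < p.sum + x + y - 1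
    · rw [if_pos hz]
      -- The position lies inside the translated B, at the new separator, or inside the translated
      -- A.
      rcases lt_trichotomy (z + 1) (p.sum + y) with hz' | hz' | hz'
      · rw [if_pos (by omega), show z + (p.sum + x - 1) - (p.sum - 1) + 1 = z + 1 + x by omega]
        simp only [List.append_assoc, isPartialSum_append, hA, hB, hP]
        rw [if_neg (by omega), if_pos (by omega), if_neg (by omega), if_neg (by omega),
          if_pos (by omega), show z + 1 + x - p.sum - x = z + 1 - p.sum by omega]
      · rw [if_neg (by omega), if_pos (by omega), show p.sum + x - 1 + 1 = p.sum + x by omega]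
        simp only [List.append_assoc, isPartialSum_append, hA, hB, hP]
        rw [if_neg (by omega), if_pos (by omega), show z + 1 - p.sum = y by omega,
          if_neg (by omega), if_pos (by omega), Nat.add_sub_cancel_left]
        exact iff_of_true hB0 hA0
      · rw [if_neg (by omega), if_neg (by omega),
          show z + (p.sum + x - 1) - (p.sum + x + y - 1) + 1 = z + 1 - y by omega]
        simp only [List.append_assoc, isPartialSum_append, hA, hB, hP]
        rw [if_neg (by omega), if_neg (by omega), if_pos (by omega), if_neg (by omega),
          if_pos (by omega), show z + 1 - y - p.sum = z + 1 - p.sum - y by omega]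
    · rw [if_neg hz]
      simp only [List.append_assoc, isPartialSum_append, hA, hB, hP]
      by_cases hz1 : z + 1 ≤ p.sum
      · rw [if_pos hz1, if_pos hz1]
      · rw [if_neg hz1, if_neg hz1]
        by_cases hz2 : z + 1 - p.sum = x + y
        · rw [hz2, if_neg (by omega), if_pos (by omega), if_neg (by omega), if_pos (by omega),
            Nat.add_sub_cancel, Nat.add_sub_cancel_left]
          exact iff_of_true hA0 hB0
        · rw [if_neg (by omega), if_neg (by omega), if_neg (by omega), if_neg (by omega),
            Nat.sub_right_comm]

end Composition
open LeafTree

/-! ### Levels of a labeled forest -/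

namespace LeafTree

variable {α β : Type}

lemma value_map (f : α → β) (T : LeafTree α) : (T.map f).value = T.value := by
  induction T with
  | leaf x => rfl
  | node a l r hl hr => simp [map, value, hl, hr]

lemma foliage_map (f : α → β) (T : LeafTree α) : (T.map f).foliage = T.foliage := by
  induction T with
  | leaf x => rfl
  | node a l r hl hr => simp [map, foliage, hl, hr]

lemma length_map (f : α → β) (T : LeafTree α) : (T.map f).length = T.length := by
  induction T with
  | leaf x => rfl
  | node a l r hl hr => simp [map, length, hl, hr]

lemma labels_map (f : α → β) (T : LeafTree α) : (T.map f).labels = T.labels.map f := by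
  induction T with
  | leaf x => rfl
  | node a l r hl hr => simp [map, labels, hl, hr]

lemma value_mirror (T : LeafTree α) : T.mirror.value = T.value := by
  induction T with
  | leaf x => rfl
  | node a l r hl hr => simp [mirror, value, hl, hr, Nat.add_comm]

lemma foliage_mirror (T : LeafTree α) : T.mirror.foliage = T.foliage.reverse := by
  induction T with
  | leaf x => rfl
  | node a l r hl hr => simp [mirror, foliage, hl, hr]

lemma length_mirror (T : LeafTree α) : T.mirror.length = T.length := by
  induction T with
  | leaf x => rfl
  | node a l r hl hr => simp [mirror, length, hl, hr, Nat.add_comm]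

lemma labels_mirror_perm (T : LeafTree α) : T.mirror.labels.Perm T.labels := by
  induction T with
  | leaf x => rfl
  | node a l r hl hr =>
    simp only [mirror, labels]
    exact ((hr.append hl).trans List.perm_append_comm).cons a

lemma mirror_map (f : α → β) (T : LeafTree α) : (T.map f).mirror = T.mirror.map f := by
  induction T with
  | leaf x => rfl
  | node a l r hl hr => simp [mirror, map, hl, hr]

lemma mirror_erase (T : LeafTree α) : T.mirror.erase = T.erase.mirror := (mirror_map _ T).symm

lemma map_map {γ : Type} (f : α → β) (g : β → γ) (T : LeafTree α) :
    (T.map f).map g = T.map (g ∘ f) := by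
  induction T with
  | leaf x => rfl
  | node a l r hl hr => simp [map, hl, hr]

lemma erase_map (f : α → β) (T : LeafTree α) : (T.map f).erase = T.erase := map_map _ _ T

lemma length_labels (T : LeafTree α) : T.labels.length = T.length := by
  induction T with
  | leaf x => rfl
  | node a l r hl hr => simp [labels, length, hl, hr]

lemma map_congr {f g : α → β} {T : LeafTree α} (h : ∀ a ∈ T.labels, f a = g a) :
    T.map f = T.map g := by
  induction T with
  | leaf x => rfl
  | node a l r hl hr =>
    simp only [labels, List.mem_cons, List.mem_append] at h
    rw [map, map, h a (Or.inl rfl), hl fun b hb => h b (by tauto), hr fun b hb => h b (by tauto)]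

lemma map_id' (T : LeafTree α) : T.map id = T := by
  induction T with
  | leaf x => rfl
  | node a l r hl hr => rw [map, hl, hr, id]

lemma map_sub_one_add_one {T : LeafTree ℕ} (h : ∀ a ∈ T.labels, 0 < a) :
    (T.map (· - 1)).map (· + 1) = T := by
  rw [map_map]
  conv_rhs => rw [← map_id' T]
  exact map_congr fun a ha => Nat.sub_add_cancel (h a ha)

lemma map_add_one_sub_one (T : LeafTree ℕ) : (T.map (· + 1)).map (· - 1) = T := by
  rw [map_map]
  conv_rhs => rw [← map_id' T]
  exact map_congr fun a _ => Nat.add_sub_cancel a 1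

/-- The foliage of the tree obtained by contracting to leaves all subtrees whose root has a label
greater than `m`. -/
def level (m : ℕ) : LeafTree ℕ → List ℕ
  | leaf x => [x]
  | node a l r => if a ≤ m then l.level m ++ r.level m else [l.value + r.value]

lemma sum_level (m : ℕ) (T : LeafTree ℕ) : (T.level m).sum = T.value := by
  induction T with
  | leaf x => simp [level, value]
  | node a l r hl hr => rw [level]; split_ifs <;> simp [value, hl, hr]

lemma level_mirror (m : ℕ) (T : LeafTree ℕ) : T.mirror.level m = (T.level m).reverse := by
  induction T with
  | leaf x => rfl
  | node a l r hl hr =>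
    rw [mirror, level, level]
    split_ifs <;> simp [hl, hr, value_mirror, Nat.add_comm]

lemma level_map_sub_one (m : ℕ) (T : LeafTree ℕ) :
    (T.map (· - 1)).level m = T.level (m + 1) := by
  induction T with
  | leaf x => rfl
  | node a l r hl hr => simp only [map, level, hl, hr, value_map, Nat.sub_le_iff_le_add]

lemma level_succ_map_add_one (m : ℕ) (T : LeafTree ℕ) :
    (T.map (· + 1)).level (m + 1) = T.level m := by
  rw [← level_map_sub_one, map_add_one_sub_one]

lemma level_zero {T : LeafTree ℕ} (h : ∀ a ∈ T.labels, 0 < a) : T.level 0 = [T.value] := by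
  cases T with
  | leaf x => rfl
  | node a l r =>
    have := h a (by simp [labels])
    rw [level, if_neg (by omega), value]

lemma level_zero_map_add_one (T : LeafTree ℕ) : (T.map (· + 1)).level 0 = [T.value] := by
  rw [level_zero, value_map]
  intro a ha
  rw [labels_map, List.mem_map] at ha
  obtain ⟨b, -, rfl⟩ := ha
  exact Nat.succ_pos b

lemma IncreasingAbove.lt {p : ℕ} {T : LeafTree ℕ} (h : T.IncreasingAbove p) :
    ∀ a ∈ T.labels, p < a := by
  induction T generalizing p with
  | leaf x => simp [labels]
  | node a l r hl hr =>
    intro b hb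
    simp only [labels, List.mem_cons, List.mem_append] at hb
    rcases hb with rfl | hb | hb
    · exact h.1
    · exact h.1.trans (hl h.2.1 b hb)
    · exact h.1.trans (hr h.2.2 b hb)

lemma IncreasingAbove.map_sub_one {p : ℕ} {T : LeafTree ℕ} (h : T.IncreasingAbove p)
    (hp : 0 < p) : (T.map (· - 1)).IncreasingAbove (p - 1) := by
  induction T generalizing p with
  | leaf x => trivial
  | node a l r hl hr =>
    have := h.1
    exact ⟨Nat.sub_lt_sub_right hp this, hl h.2.1 (by omega), hr h.2.2 (by omega)⟩

lemma IncreasingAbove.increasing {p : ℕ} {T : LeafTree ℕ} (h : T.IncreasingAbove p) :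
    T.Increasing := by
  cases T with
  | leaf x => trivial
  | node a l r => exact h.2

lemma Increasing.map_sub_one {T : LeafTree ℕ} (h : T.Increasing)
    (hT : ∀ a ∈ T.labels, 0 < a) : (T.map (· - 1)).Increasing := by
  cases T with
  | leaf x => trivial
  | node a l r =>
    have := hT a (by simp [labels])
    exact ⟨h.1.map_sub_one this, h.2.map_sub_one this⟩

lemma IncreasingAbove.mirror {p : ℕ} {T : LeafTree ℕ} (h : T.IncreasingAbove p) :
    T.mirror.IncreasingAbove p := by
  induction T generalizing p with
  | leaf x => trivial
  | node a l r hl hr => exact ⟨h.1, hr h.2.2, hl h.2.1⟩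

lemma Increasing.mirror {T : LeafTree ℕ} (h : T.Increasing) : T.mirror.Increasing := by
  cases T with
  | leaf x => trivial
  | node a l r => exact ⟨h.2.mirror, h.1.mirror⟩

lemma value_pos {T : LeafTree α} (h : ∀ x ∈ T.foliage, 0 < x) : 0 < T.value := by
  induction T with
  | leaf x => exact h x (by simp [foliage])
  | node a l r hl hr =>
    have := hl fun x hx => h x (by simp [foliage, hx])
    rw [value]
    omega

end LeafTree

/-- The foliage of the forest obtained by contracting to leaves all subtrees whose root has a
label greater than `m`. -/
def forestLevel (X : List (LeafTree ℕ)) (m : ℕ) : List ℕ := X.flatMap (LeafTree.level m)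

lemma forestLevel_append (X Y : List (LeafTree ℕ)) (m : ℕ) :
    forestLevel (X ++ Y) m = forestLevel X m ++ forestLevel Y m := List.flatMap_append

lemma forestLevel_cons (T : LeafTree ℕ) (Y : List (LeafTree ℕ)) (m : ℕ) :
    forestLevel (T :: Y) m = T.level m ++ forestLevel Y m := List.flatMap_cons

lemma sum_forestLevel (X : List (LeafTree ℕ)) (m : ℕ) :
    (forestLevel X m).sum = (forestSquash X).sum := by
  induction X with
  | nil => rfl
  | cons T X ih =>
    rw [forestLevel_cons, List.sum_append, ih, sum_level]
    simp [forestSquash]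

lemma forestLevel_zero {X : List (LeafTree ℕ)} (h : ∀ a ∈ forestLabels X, 0 < a) :
    forestLevel X 0 = forestSquash X := by
  induction X with
  | nil => rfl
  | cons T X ih =>
    simp only [forestLabels, List.flatMap_cons, List.mem_append] at h ih
    rw [forestLevel_cons, ih fun a ha => h a (Or.inr ha), level_zero fun a ha => h a (Or.inl ha)]
    rfl

lemma forestLevel_zero_map_add_one (X : List (LeafTree ℕ)) :
    forestLevel (X.map (LeafTree.map (· + 1))) 0 = forestSquash X := by
  induction X with
  | nil => rfl
  | cons T X ih =>
    rw [List.map_cons, forestLevel_cons, ih, level_zero_map_add_one]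
    rfl

lemma forestLevel_map_add_one (X : List (LeafTree ℕ)) (m : ℕ) :
    forestLevel (X.map (LeafTree.map (· + 1))) (m + 1) = forestLevel X m := by
  induction X with
  | nil => rfl
  | cons T X ih =>
    rw [List.map_cons, forestLevel_cons, ih, level_succ_map_add_one]
    rfl

lemma forestLevel_map_sub_one (X : List (LeafTree ℕ)) (m : ℕ) :
    forestLevel (X.map (LeafTree.map (· - 1))) m = forestLevel X (m + 1) := by
  induction X with
  | nil => rfl
  | cons T X ih =>
    rw [List.map_cons, forestLevel_cons, ih, level_map_sub_one]
    rfl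

lemma forestLevel_leaves (c : List ℕ) (m : ℕ) : forestLevel (c.map leaf) m = c := by
  induction c with
  | nil => rfl
  | cons x c ih => rw [List.map_cons, forestLevel_cons, ih]; rfl

lemma forestSquash_leaves (c : List ℕ) : forestSquash (c.map leaf : List (LeafTree ℕ)) = c := by
  simp [forestSquash, Function.comp_def, value]

lemma length_forestLabels {α : Type} (X : List (LeafTree α)) :
    (forestLabels X).length = forestLength X := by
  simp [forestLabels, forestLength, List.length_flatMap, length_labels]

lemma forestLength_append {α : Type} (X Y : List (LeafTree α)) :
    forestLength (X ++ Y) = forestLength X + forestLength Y := by simp [forestLength]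

lemma forestLength_cons {α : Type} (T : LeafTree α) (Y : List (LeafTree α)) :
    forestLength (T :: Y) = T.length + forestLength Y := by simp [forestLength]

lemma forestLength_map {α β : Type} (f : α → β) (X : List (LeafTree α)) :
    forestLength (X.map (LeafTree.map f)) = forestLength X := by
  simp [forestLength, Function.comp_def, length_map]

lemma forestLength_leaves (c : List ℕ) :
    forestLength (c.map leaf : List (LeafTree ℕ)) = 0 := by
  induction c with
  | nil => rfl
  | cons x c ih => rw [List.map_cons, forestLength_cons, ih]; rfl

/-- Positivity of y makes x + y differ from x, so the comparison of heads first fails at the part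
that is split. -/
lemma splitForest_eq (p r : List ℕ) (x : ℕ) {y : ℕ} (hy : 0 < y) :
    splitForest (p ++ (x + y) :: r) (p ++ x :: y :: r) =
      p.map leaf ++ LeafTree.node 1 (leaf x) (leaf y) :: r.map leaf := by
  induction p with
  | nil => simp [splitForest, hy.ne']
  | cons a p ih => simp [splitForest, ih]

lemma forestGraft_leaves_append {α : Type} {p : List ℕ} {A : List (LeafTree α)}
    (h : A.length = p.length) (X Y : List (LeafTree α)) :
    forestGraft (p.map leaf ++ X) (A ++ Y) = A ++ forestGraft X Y := by
  induction p generalizing A with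
  | nil => simp [List.length_eq_zero_iff.1 h]
  | cons a p ih =>
    cases A with
    | nil => simp at h
    | cons T A =>
      simp only [List.length_cons, Nat.add_right_cancel_iff] at h
      simp [forestGraft, foliage, graft, ih h]

lemma forestGraft_leaves {α : Type} {p : List ℕ} {A : List (LeafTree α)}
    (h : A.length = p.length) : forestGraft (p.map leaf) A = A := by
  have := forestGraft_leaves_append h [] []
  simpa [forestGraft] using this

/-- Up to the shift of labels, this undoes the removal of the node labeled 1 in
`IsLabeledForest.remove_root`. -/
lemma forestMul_split {p r : List ℕ} {A C : List (LeafTree ℕ)} (hA : A.length = p.length)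
    (hC : C.length = r.length) (x y : ℕ) (L R : LeafTree ℕ) :
    forestMul (p.map leaf ++ LeafTree.node 1 (leaf x) (leaf y) :: r.map leaf) (A ++ L :: R :: C) =
      A.map (LeafTree.map (· + 1)) ++ LeafTree.node 1 (L.map (· + 1)) (R.map (· + 1)) ::
        C.map (LeafTree.map (· + 1)) := by
  have hl : forestLength (p.map leaf ++ LeafTree.node 1 (leaf x) (leaf y) :: r.map leaf) = 1 := by
    rw [forestLength_append, forestLength_cons, forestLength_leaves, forestLength_leaves]
    rfl
  rw [forestMul, hl, List.map_append, forestGraft_leaves_append (by simpa using hA)]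
  simp only [List.map_cons, forestGraft, foliage, List.length_append,
    List.length_singleton, graft, List.take_succ_cons, List.take_zero, List.drop_succ_cons,
    List.drop_zero, List.headD_cons]
  rw [forestGraft_leaves (by simpa using hC)]

/-! ### Labeled forests -/

lemma IsLabeledForest.labels_pos {N : ℕ} {X : List (LeafTree ℕ)} (h : IsLabeledForest N X) :
    ∀ a ∈ forestLabels X, 0 < a := by
  intro a ha
  have := (h.labels_perm.mem_iff).1 ha
  rw [List.mem_range'_1] at this
  omega

/-- Labels are positive and those below a root exceed the label of the root, so 1 can only sit at a
root. -/
lemma IsLabeledForest.exists_root_one {N : ℕ} {X : List (LeafTree ℕ)} (h : IsLabeledForest N X)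
    (hl : 0 < forestLength X) : ∃ A L R C, X = A ++ LeafTree.node 1 L R :: C := by
  have h1 : 1 ∈ forestLabels X := by
    rw [h.labels_perm.mem_iff, List.mem_range'_1]
    omega
  obtain ⟨T, hT, h1T⟩ := List.mem_flatMap.1 h1
  obtain ⟨A, C, rfl⟩ := List.append_of_mem hT
  cases T with
  | leaf x => simp [labels] at h1T
  | node a L R =>
    have ha : 0 < a := h.labels_pos a (List.mem_flatMap.2 ⟨_, hT, by simp [labels]⟩)
    have hi := h.increasing _ hT
    simp only [labels, List.mem_cons, List.mem_append] at h1T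
    rcases h1T with rfl | h1T | h1T
    · exact ⟨A, L, R, C, rfl⟩
    · have := hi.1.lt 1 h1T
      omega
    · have := hi.2.lt 1 h1T
      omega

/-- Remove the node labeled `1` from a labeled forest. -/
lemma IsLabeledForest.remove_root {N : ℕ} {A C : List (LeafTree ℕ)} {L R : LeafTree ℕ}
    (h : IsLabeledForest N (A ++ LeafTree.node 1 L R :: C)) :
    IsLabeledForest N ((A ++ L :: R :: C).map (LeafTree.map (· - 1))) := by
  have hpos := h.labels_pos
  have hfol : forestFoliage ((A ++ L :: R :: C).map (LeafTree.map (· - 1))) =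
      forestFoliage (A ++ LeafTree.node 1 L R :: C) := by
    simp [forestFoliage, List.flatMap_map, foliage_map, foliage]
  refine ⟨?_, ?_, ?_, ?_⟩
  · rw [hfol]; exact h.leaves_pos
  · rw [← h.value_eq]
    simp [forestSquash, Function.comp_def, value_map, value, Nat.add_assoc]
  · intro T hT
    obtain ⟨T', hT', rfl⟩ := List.mem_map.1 hT
    clear hT
    rename' T' => T, hT' => hT
    have hi := h.increasing (LeafTree.node 1 L R) (by simp)
    rcases List.mem_append.1 hT with hT | hT
    · have hT' : T ∈ A ++ LeafTree.node 1 L R :: C := List.mem_append_left _ hT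
      exact (h.increasing T hT').map_sub_one fun a ha =>
        hpos a (List.mem_flatMap.2 ⟨T, hT', ha⟩)
    · rcases List.mem_cons.1 hT with rfl | hT
      · exact (hi.1.map_sub_one one_pos).increasing
      rcases List.mem_cons.1 hT with rfl | hT
      · exact (hi.2.map_sub_one one_pos).increasing
      · have hT' : T ∈ A ++ LeafTree.node 1 L R :: C :=
          List.mem_append_right _ (List.mem_cons_of_mem _ hT)
        exact (h.increasing T hT').map_sub_one fun a ha =>
          hpos a (List.mem_flatMap.2 ⟨T, hT', ha⟩)
  · have h1 : (1 :: forestLabels (A ++ L :: R :: C)).Perm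
        (forestLabels (A ++ LeafTree.node 1 L R :: C)) := by
      simp only [forestLabels, List.flatMap_append, List.flatMap_cons, labels, List.cons_append,
        List.append_assoc]
      exact List.perm_middle.symm
    have h2 : forestLength (A ++ LeafTree.node 1 L R :: C) =
        forestLength (A ++ L :: R :: C) + 1 := by
      simp only [forestLength_append, forestLength_cons, length]
      omega
    have h3 := h1.trans h.labels_perm
    rw [h2, List.range'_succ, List.perm_cons] at h3
    have h4 := h3.map (· - 1)
    rw [forestLength_map]
    have h5 : forestLabels ((A ++ L :: R :: C).map (LeafTree.map (· - 1))) =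
        (forestLabels (A ++ L :: R :: C)).map (· - 1) := by
      simp [forestLabels, List.flatMap_map, List.map_flatMap, labels_map]
    rw [h5]
    exact h4.trans (List.Perm.of_eq (List.map_sub_range' (a := 1) (s := 2) (by omega) _))

lemma forestLength_remove_root (A C : List (LeafTree ℕ)) (L R : LeafTree ℕ) :
    forestLength ((A ++ L :: R :: C).map (LeafTree.map (· - 1))) + 1 =
      forestLength (A ++ LeafTree.node 1 L R :: C) := by
  rw [forestLength_map]
  simp only [forestLength_append, forestLength_cons, length]
  omega

lemma forestLevel_remove_root (A C : List (LeafTree ℕ)) (L R : LeafTree ℕ) (m : ℕ) :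
    forestLevel ((A ++ L :: R :: C).map (LeafTree.map (· - 1))) m =
      forestLevel (A ++ LeafTree.node 1 L R :: C) (m + 1) := by
  rw [forestLevel_map_sub_one]
  simp [forestLevel_append, forestLevel_cons, level]

/-! ### Chains of subsets as the levels of a forest -/

section Chain

variable {n : ℕ}

/-- A chain of subsets is mapped to a labeled forest if the compositions of the subsets are the
levels of the forest. -/
lemma chainForest_eq_of_levels {N : ℕ} {X : List (LeafTree ℕ)} (hX : IsLabeledForest N X)
    {a : List (Finset (Fin n))}
    (ha : a.map composition = (List.range (forestLength X + 1)).map (forestLevel X)) :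
    chainForest a = X := by
  induction h : forestLength X generalizing X a with
  | zero =>
    rw [h] at ha
    obtain ⟨J, rfl⟩ : ∃ J, a = [J] := by
      rw [← List.length_eq_one_iff]
      simpa using congrArg List.length ha
    rw [zero_add, List.range_one, List.map_singleton, List.map_singleton,
      forestLevel_zero hX.labels_pos] at ha
    rw [chainForest, List.singleton_inj.1 ha]
    refine (eq_leaves_of_labels_nil X ?_).symm
    rw [← List.length_eq_zero_iff, length_forestLabels, h]
  | succ l ih =>
    obtain ⟨A, L, R, C, rfl⟩ := hX.exists_root_one (by omega)
    have hY := hX.remove_root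
    have hlen := forestLength_remove_root A C L R
    have hlev := forestLevel_remove_root A C L R
    have hpos := hX.labels_pos
    have h0 := forestLevel_zero hpos
    set Y := (A ++ L :: R :: C).map (LeafTree.map (· - 1)) with hYdef
    -- Level m + 1 of the forest is level m of the forest without the node labeled 1, so the tail of
    -- the chain falls under the induction hypothesis.
    have ha' : a.map composition = forestSquash (A ++ LeafTree.node 1 L R :: C) ::
        (List.range (forestLength Y + 1)).map (forestLevel Y) := by
      rw [ha, ← hlen, List.range_succ_eq_map, List.map_cons, h0, List.map_map]
      exact congrArg _ (List.map_congr_left fun m _ => (hlev m).symm)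
    obtain ⟨J, b, rfl, hJ, hb⟩ := List.map_eq_cons_iff.1 ha'
    have hbY := ih hY hb (by omega)
    rw [List.range_succ_eq_map, List.map_cons] at hb
    obtain ⟨K, b, rfl, hK, -⟩ := List.map_eq_cons_iff.1 hb
    rw [forestLevel_zero hY.labels_pos] at hK
    have hRpos : 0 < R.value := value_pos fun x hx =>
      hX.leaves_pos x (by simp [forestFoliage, foliage, hx])
    have hJ' : composition J = forestSquash A ++ (L.value + R.value) :: forestSquash C := by
      rw [hJ]; simp [forestSquash, value]
    have hK' : composition K = forestSquash A ++ L.value :: R.value :: forestSquash C := by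
      rw [hK, hYdef]; simp [forestSquash, value_map, Function.comp_def]
    have hlab : ∀ T ∈ A ++ LeafTree.node 1 L R :: C, ∀ a ∈ T.labels, 0 < a := fun T hT a ha =>
      hpos a (List.mem_flatMap.2 ⟨T, hT, ha⟩)
    have hback : ∀ D : List (LeafTree ℕ), (∀ T ∈ D, ∀ a ∈ T.labels, 0 < a) →
        (D.map (LeafTree.map (· - 1))).map (LeafTree.map (· + 1)) = D := by
      intro D hD
      rw [List.map_map]
      conv_rhs => rw [← List.map_id D]
      exact List.map_congr_left fun T hT => map_sub_one_add_one (hD T hT)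
    have hnode := hlab (LeafTree.node 1 L R) (by simp)
    simp only [labels, List.mem_cons, List.mem_append] at hnode
    rw [chainForest, hbY, hJ', hK', splitForest_eq _ _ _ hRpos, hYdef]
    rw [List.map_append, List.map_cons, List.map_cons,
      forestMul_split (by simp [forestSquash]) (by simp [forestSquash]),
      hback A fun T hT => hlab T (by simp [hT]), hback C fun T hT => hlab T (by simp [hT]),
      map_sub_one_add_one fun a ha => hnode a (by tauto),
      map_sub_one_add_one fun a ha => hnode a (by tauto)]

/-- Merging deletes the cut between x and y and no other; positivity keeps this cut apart from its
neighbours. -/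
lemma isPartialSum_merge {p r : List ℕ} {x y w : ℕ} (hx : 0 < x) (hy : 0 < y) :
    IsPartialSum (p ++ (x + y) :: r) w ↔
      IsPartialSum (p ++ x :: y :: r) w ∧ w ≠ p.sum + x := by
  simp only [isPartialSum_append]
  split_ifs with h
  · exact ⟨fun h' => ⟨h', by omega⟩, fun h' => h'.1⟩
  · simp only [isPartialSum_cons]
    constructor
    · rintro (h' | ⟨z, h', h''⟩)
      · omega
      · exact ⟨Or.inr ⟨y + z, Or.inr ⟨z, h', rfl⟩, by omega⟩, by omega⟩
    · rintro ⟨h' | ⟨z, h' | ⟨v, h', rfl⟩, h''⟩, h3⟩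
      · omega
      · omega
      · exact Or.inr ⟨v, h', by omega⟩

/-- Removing an element from a subset splits one part of the composition. -/
lemma exists_split {J K : Finset (Fin n)} (hKJ : K ⊆ J) (h : (J \ K).card = 1) :
    ∃ p x y r, 0 < x ∧ 0 < y ∧ composition J = p ++ (x + y) :: r ∧
      composition K = p ++ x :: y :: r := by
  obtain ⟨s, hs⟩ := Finset.card_eq_one.1 h
  have hs' : ∀ k, (k ∈ J ∧ k ∉ K) ↔ k = s := fun k => by
    rw [← Finset.mem_sdiff, hs, Finset.mem_singleton]
  obtain ⟨h1, h2, h3⟩ := composition_spec K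
  have hsb : IsBoundary K s := ⟨s.2.le, fun k hk hks =>
    ((hs' s).2 rfl).2 (by rwa [← Fin.ext hks])⟩
  obtain ⟨q, ⟨t, ht⟩, hq⟩ := (h3 s).2 hsb
  have hqne : q ≠ [] := by rintro rfl; simp at hq
  obtain ⟨p, x, rfl⟩ : ∃ p x, q = p ++ [x] := ⟨_, _, (List.dropLast_append_getLast hqne).symm⟩
  -- The cut s + 1 is less than the total n + 1, so some part follows it.
  have htne : t ≠ [] := by
    rintro rfl
    rw [List.append_nil] at ht
    rw [← ht, hq] at h2
    have := s.2
    omega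
  obtain ⟨y, r, rfl⟩ := List.exists_cons_of_ne_nil htne
  have hK : composition K = p ++ x :: y :: r := by rw [← ht]; simp
  have hx : 0 < x := h1 x (by simp [hK])
  have hy : 0 < y := h1 y (by simp [hK])
  refine ⟨p, x, y, r, hx, hy, composition_eq (fun z hz => ?_) fun z => ?_, hK⟩
  · simp only [List.mem_append, List.mem_cons] at hz
    rcases hz with hz | rfl | hz
    · exact h1 z (by simp [hK, hz])
    · omega
    · exact h1 z (by simp [hK, hz])
  · rw [isPartialSum_merge hx hy, ← hK, h3]
    rw [List.sum_append, List.sum_singleton] at hq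
    constructor
    · rintro ⟨hz, hz'⟩
      refine ⟨hz.1, fun k hk hkz => ?_⟩
      by_cases hkK : k ∈ K
      · exact hz.2 k hkK hkz
      · have := (hs' k).1 ⟨hk, hkK⟩
        subst this
        omega
    · rintro ⟨hz, hz'⟩
      refine ⟨⟨hz, fun k hk => hz' k (hKJ hk)⟩, fun h => ?_⟩
      exact hz' s ((hs' s).2 rfl).1 (by omega)

/-- The compositions of the subsets of a chain are the levels of its forest. -/
lemma levels_chainForest {a : List (Finset (Fin n))} (ha : IsSubsetChain a) :
    a.length = forestLength (chainForest a) + 1 ∧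
    a.map composition = (List.range a.length).map (forestLevel (chainForest a)) ∧
    ∀ J b, a = J :: b → forestSquash (chainForest a) = composition J := by
  obtain ⟨hne, hc⟩ := ha
  induction a with
  | nil => exact absurd rfl hne
  | cons J b ih =>
    cases b with
    | nil =>
      refine ⟨by simp [chainForest, forestLength_leaves], ?_, ?_⟩
      · simp [chainForest, forestLevel_leaves]
      · rintro J' b ⟨rfl, rfl⟩
        rw [chainForest, forestSquash_leaves]
    | cons K b =>
      rw [List.isChain_cons_cons] at hc
      obtain ⟨hlen, hlev, hsq⟩ := ih (by simp) hc.2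
      obtain ⟨p, x, y, r, hx, hy, hJ, hK⟩ := exists_split hc.1.1 hc.1.2
      have hsqK := hsq K b rfl
      rw [chainForest]
      generalize chainForest (K :: b) = Y at *
      rw [hK, forestSquash] at hsqK
      -- The parts of the composition of K are the values of the trees of Y. The trees L and R over
      -- the parts x and y become the children of the new root.
      obtain ⟨A, D, rfl, hA, hD⟩ := List.map_eq_append_iff.1 hsqK
      obtain ⟨L, D, rfl, hL, hD⟩ := List.map_eq_cons_iff.1 hD
      obtain ⟨R, C, rfl, hR, hC⟩ := List.map_eq_cons_iff.1 hD
      rw [hJ, hK, splitForest_eq _ _ _ hy,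
        forestMul_split (by simp [← hA]) (by simp [← hC])]
      refine ⟨?_, ?_, ?_⟩
      · rw [List.length_cons, hlen]
        simp only [forestLength_append, forestLength_cons, forestLength_map, length, length_map]
        omega
      · rw [show (J :: K :: b).map composition = composition J :: (K :: b).map composition from rfl,
          hlev, List.length_cons (as := K :: b), List.range_succ_eq_map, List.map_cons, List.map_map,
          hJ]
        congr 1
        · rw [forestLevel_append, forestLevel_cons, forestLevel_zero_map_add_one,
            forestLevel_zero_map_add_one, level, if_neg (by omega), value_map, value_map, hL, hR,
            forestSquash, forestSquash, hA, hC]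
          rfl
        · refine List.map_congr_left fun m _ => ?_
          simp only [Function.comp_apply, Nat.succ_eq_add_one, forestLevel_append,
            forestLevel_cons, forestLevel_map_add_one, level, level_succ_map_add_one]
          rw [if_pos (by omega), List.append_assoc]
      · rintro J' b' ⟨rfl, rfl⟩
        rw [hJ, ← hA, ← hC, ← hL, ← hR]
        simp [forestSquash, value_map, Function.comp_def, value]

end Chain
/-! ### The action of the generators on labeled forests -/

lemma IsLabeledForest.perm {N : ℕ} {X Y : List (LeafTree ℕ)} (h : IsLabeledForest N X)
    (hXY : X.Perm Y) : IsLabeledForest N Y := by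
  refine ⟨fun x hx => h.leaves_pos x ?_, ?_, fun U hU => h.increasing U (hXY.mem_iff.2 hU), ?_⟩
  · exact (hXY.flatMap_right _).mem_iff.2 hx
  · rw [← h.value_eq]; exact ((hXY.map _).sum_eq).symm
  · rw [show forestLength Y = forestLength X from ((hXY.map _).sum_eq).symm]
    exact (hXY.flatMap_right _).symm.trans h.labels_perm

lemma IsLabeledForest.mirror {N : ℕ} {A C : List (LeafTree ℕ)} {T : LeafTree ℕ}
    (h : IsLabeledForest N (A ++ T :: C)) : IsLabeledForest N (A ++ T.mirror :: C) := by
  refine ⟨fun x hx => h.leaves_pos x ?_, ?_, fun U hU => ?_, ?_⟩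
  · simpa [forestFoliage, foliage_mirror] using hx
  · rw [← h.value_eq]
    simp [forestSquash, value_mirror]
  · rw [List.mem_append, List.mem_cons] at hU
    rcases hU with hU | rfl | hU
    · exact h.increasing U (by simp [hU])
    · exact (h.increasing T (by simp)).mirror
    · exact h.increasing U (by simp [hU])
  · rw [show forestLength (A ++ T.mirror :: C) = forestLength (A ++ T :: C) by
      simp only [forestLength_append, forestLength_cons, length_mirror]]
    refine List.Perm.trans ?_ h.labels_perm
    simp only [forestLabels, List.flatMap_append, List.flatMap_cons]
    exact ((labels_mirror_perm T).append_right _).append_left _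

section Action

variable {n : ℕ}

/-- Since a forest is recovered from its levels, a map on subsets need only be followed on the
composition at each level. -/
lemma chainForest_map {N : ℕ} {a : List (Finset (Fin n))} (ha : IsSubsetChain a)
    {X : List (LeafTree ℕ)} (hX : IsLabeledForest N X)
    (hlen : forestLength X = forestLength (chainForest a)) {g : Finset (Fin n) → Finset (Fin n)}
    (hg : ∀ J ∈ a, ∀ m, composition J = forestLevel (chainForest a) m →
      composition (g J) = forestLevel X m) : chainForest (a.map g) = X := by
  obtain ⟨h1, h2, -⟩ := levels_chainForest ha
  refine chainForest_eq_of_levels hX ?_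
  rw [hlen, ← h1]
  refine List.ext_getElem (by simp) fun i hi hi' => ?_
  simp only [List.length_map] at hi
  have h3 : composition a[i] = forestLevel (chainForest a) i := by
    have h4 : (a.map composition)[i]? =
      ((List.range a.length).map (forestLevel (chainForest a)))[i]? := by rw [h2]
    simpa [hi] using h4
  simpa using hg _ (List.getElem_mem hi) i h3

variable {W : Type*} [Group W] (cs : CoxeterSystem (typeB n) W)

/-- At every level the parts from U have sum U.value and those from T have sum T.value, so the same
segment is reversed throughout. Reversing all levels of a tree mirrors it. -/
lemma chainForest_chainAct_mirror {N : ℕ} {J₀ : Finset (Fin n)} {a : List (Finset (Fin n))}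
    (ha : IsSubsetChain (J₀ :: a)) {U T : LeafTree ℕ} {V : List (LeafTree ℕ)}
    (hφ : chainForest (J₀ :: a) = U :: T :: V) (hX : IsLabeledForest N (U :: T :: V)) {s : Fin n}
    (hs : (s : ℕ) + 1 = U.value) :
    chainForest (chainAct cs (J₀ :: a) s) = U :: T.mirror :: V := by
  refine chainForest_map ha (hX.mirror (A := [U])) ?_ fun J hJ m h => ?_
  · rw [hφ]
    simp only [List.singleton_append, forestLength_cons, length_mirror]
  · have h0 := (levels_chainForest ha).2.2 J₀ a rfl
    rw [hφ] at h0 h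
    rw [List.singleton_append, forestLevel_cons, forestLevel_cons, level_mirror, ← List.append_assoc]
    exact composition_conjSubset_reverse cs (ha.subset hJ) (r := forestSquash V) h0.symm hs
      (by rw [h, forestLevel_cons, forestLevel_cons, List.append_assoc])
      (sum_level m U) (sum_level m T)

/-- Again the segments from S and T have the same sums at all levels, so whole trees are exchanged.
-/
lemma chainForest_chainAct_swap {N : ℕ} {J₀ : Finset (Fin n)} {a : List (Finset (Fin n))}
    (ha : IsSubsetChain (J₀ :: a)) {P V : List (LeafTree ℕ)} {S T : LeafTree ℕ} (hP : P ≠ [])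
    (hφ : chainForest (J₀ :: a) = P ++ S :: T :: V) (hX : IsLabeledForest N (P ++ S :: T :: V))
    {s : Fin n} (hs : (s : ℕ) + 1 = (forestSquash P).sum + S.value) :
    chainForest (chainAct cs (J₀ :: a) s) = P ++ T :: S :: V := by
  have hperm : (P ++ S :: T :: V).Perm (P ++ T :: S :: V) := (List.Perm.swap _ _ _).append_left _
  refine chainForest_map ha (hX.perm hperm) ?_ fun J hJ m h => ?_
  · rw [hφ]
    exact ((hperm.map _).sum_eq).symm
  · have h0 := (levels_chainForest ha).2.2 J₀ a rfl
    rw [hφ] at h0 h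
    have h1 := composition_conjSubset_swap cs (ha.subset hJ) (p := forestSquash P)
      (x := S.value) (y := T.value) (r := forestSquash V)
      (by rw [← h0]; simp [forestSquash]) (by simpa [forestSquash] using hP) hs
      (P := forestLevel P m) (A := S.level m) (B := T.level m) (C := forestLevel V m)
      (by rw [h]; simp [forestLevel_append, forestLevel_cons])
      (sum_forestLevel P m) (sum_level m S) (sum_level m T)
    rw [h1]
    simp [forestLevel_append, forestLevel_cons]

/-- The chain obtained by omitting the first subset belongs to the forest obtained by removing
the node labeled `1`. -/
lemma exists_tail_chain {N : ℕ} {a : List (Finset (Fin n))} (ha : IsSubsetChain a)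
    {A C : List (LeafTree ℕ)} {L R : LeafTree ℕ}
    (hφ : chainForest a = A ++ LeafTree.node 1 L R :: C)
    (hX : IsLabeledForest N (A ++ LeafTree.node 1 L R :: C)) :
    ∃ J K b s, a = J :: K :: b ∧ J \ K = {s} ∧ IsSubsetChain (K :: b) ∧
      chainForest (K :: b) = (A ++ L :: R :: C).map (LeafTree.map (· - 1)) ∧
      (s : ℕ) + 1 = (forestSquash A).sum + L.value := by
  obtain ⟨h1, h2, h3⟩ := levels_chainForest ha
  have hlen := forestLength_remove_root A C L R
  rw [hφ] at h1 h2 h3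
  have h4 : 2 ≤ a.length := by omega
  obtain ⟨J, K, b, rfl⟩ : ∃ J K b, a = J :: K :: b := by
    match a, h4 with
    | J :: K :: b, _ => exact ⟨J, K, b, rfl⟩
  have hc := ha.2
  rw [List.isChain_cons_cons] at hc
  obtain ⟨s, hs⟩ := Finset.card_eq_one.1 hc.1.2
  have hb : IsSubsetChain (K :: b) := ⟨by simp, hc.2⟩
  have hY : chainForest (K :: b) = (A ++ L :: R :: C).map (LeafTree.map (· - 1)) := by
    refine chainForest_eq_of_levels hX.remove_root ?_
    rw [hlen, List.map_congr_left fun m _ => forestLevel_remove_root A C L R m]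
    rw [h1, List.range_succ_eq_map] at h2
    have h5 := (List.cons.inj (h2 : composition J :: (K :: b).map composition =
      _ :: (List.map Nat.succ _).map _)).2
    rwa [List.map_map] at h5
  refine ⟨J, K, b, s, rfl, hs, hb, hY, ?_⟩
  have hJ := h3 J _ rfl
  have hK := (levels_chainForest hb).2.2 K b rfl
  have hL0 : 0 < L.value := value_pos fun x hx =>
    hX.leaves_pos x (by simp [forestFoliage, foliage, hx])
  have hR0 : 0 < R.value := value_pos fun x hx =>
    hX.leaves_pos x (by simp [forestFoliage, foliage, hx])
  have hJ' : composition J = forestSquash A ++ (L.value + R.value) :: forestSquash C := by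
    rw [← hJ]; simp [forestSquash, value]
  have hK' : composition K = forestSquash A ++ L.value :: R.value :: forestSquash C := by
    rw [← hK, hY]; simp [forestSquash, value_map, Function.comp_def]
  have hsJK : s ∈ J \ K := by rw [hs]; exact Finset.mem_singleton_self s
  rw [Finset.mem_sdiff] at hsJK
  -- Any cut of K other than the one between L and R survives in J. If s gave such a cut it would
  -- not belong to J.
  by_contra hne
  have hsb : IsBoundary K s := ⟨s.2.le, fun k hk hks => hsJK.2 (by rwa [← Fin.ext hks])⟩
  rw [← (composition_spec K).2.2, hK'] at hsb
  have := isPartialSum_merge (w := s + 1) (p := forestSquash A) (r := forestSquash C) hL0 hR0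
  rw [← hJ', (composition_spec J).2.2] at this
  exact (this.2 ⟨hsb, hne⟩).2 s hsJK.1 rfl

end Action

/-! ### The operator `δ` -/

section Delta

variable (k : Type*) [Field k]

lemma ofForest_append {α : Type} (X Y : List (LeafTree α)) :
    ofForest k (X ++ Y) = ofForest k X * ofForest k Y := by
  simp only [ofForest, FreeMonoid.ofList_append, map_mul]

lemma ofForest_cons {α : Type} (T : LeafTree α) (Y : List (LeafTree α)) :
    ofForest k (T :: Y) = ofForest k [T] * ofForest k Y := ofForest_append k [T] Y

lemma ofForest_nil {α : Type} : ofForest k ([] : List (LeafTree α)) = 1 :=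
  map_one (MonoidAlgebra.of k _)

lemma lowerLabels_ofForest (X : List (LeafTree ℕ)) :
    lowerLabels k (ofForest k X) = ofForest k (X.map (LeafTree.map (· - 1))) := by
  simp only [lowerLabels, ofForest, MonoidAlgebra.mapDomainAlgHom_apply, MonoidAlgebra.of_apply,
    MonoidAlgebra.mapDomain_single]
  rfl

lemma liePi_ofForest_singleton (T : LeafTree Unit) : liePi k (ofForest k [T]) = lieTree k T := by
  simp only [liePi, ofForest, MonoidAlgebra.lift_of, FreeMonoid.ofList_singleton,
    FreeMonoid.lift_eval_of]

lemma liePi_ofForest_leaves (c : List ℕ) :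
    liePi k (ofForest k (c.map leaf)) = MonoidAlgebra.of k _ (FreeMonoid.ofList c) := by
  induction c with
  | nil => exact (map_one (liePi k)).trans (map_one (MonoidAlgebra.of k _)).symm
  | cons x c ih =>
    rw [List.map_cons, ofForest_cons, map_mul, liePi_ofForest_singleton, ih,
      FreeMonoid.ofList_cons, map_mul]
    rfl

lemma liePi_ofForest_sub_swap (A C : List (LeafTree Unit)) (L R : LeafTree Unit) :
    liePi k (ofForest k (A ++ L :: R :: C)) - liePi k (ofForest k (A ++ R :: L :: C)) =
      liePi k (ofForest k (A ++ LeafTree.node () L R :: C)) := by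
  simp only [ofForest_append, ofForest_cons k L (R :: C), ofForest_cons k R C,
    ofForest_cons k R (L :: C), ofForest_cons k L C, ofForest_cons k (LeafTree.node () L R) C,
    map_mul, liePi_ofForest_singleton, lieTree, mul_sub, sub_mul, mul_assoc]

variable {n : ℕ} {W : Type*} [Group W] (cs : CoxeterSystem (typeB n) W)

lemma delta_single {J K : Finset (Fin n)} {b : List (Finset (Fin n))} {s : Fin n}
    (h : J \ K = {s}) : delta cs k (Finsupp.single (J :: K :: b) 1) =
      Finsupp.single (K :: b) 1 - Finsupp.single (chainAct cs (K :: b) s) 1 := by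
  rw [delta, Finsupp.linearCombination_single, one_smul, deltaChain, h, Finset.sum_singleton]

lemma Delta_single (a : List (Finset (Fin n))) : Delta cs k (Finsupp.single a 1) =
    toSubsets k (((delta cs k) ^ (a.length - 1)) (Finsupp.single a 1)) := by
  rw [Delta, Finsupp.linearCombination_single, one_smul]

/-- The action preserves the length of a chain, so the same power of δ is due on both terms. -/
lemma Delta_single_cons {J K : Finset (Fin n)} {b : List (Finset (Fin n))} {s : Fin n}
    (h : J \ K = {s}) : Delta cs k (Finsupp.single (J :: K :: b) 1) =
      Delta cs k (Finsupp.single (K :: b) 1) -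
        Delta cs k (Finsupp.single (chainAct cs (K :: b) s) 1) := by
  rw [Delta_single, Delta_single, Delta_single, ← map_sub]
  simp only [List.length_cons, Nat.add_sub_cancel, chainAct, List.length_map]
  rw [pow_succ, Module.End.mul_apply, delta_single k cs h, map_sub]
  rfl

lemma phiChains_single (a : List (Finset (Fin n))) :
    phiChains k (Finsupp.single a 1) = ofForest k (chainForest a) := by
  rw [phiChains, Finsupp.linearCombination_single, one_smul]

/-- `δ` at a forest whose first tree has the root labeled `1`. -/
lemma phiChains_delta_first {N : ℕ} {a : List (Finset (Fin n))} (ha : IsSubsetChain a)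
    {C : List (LeafTree ℕ)} {L R : LeafTree ℕ}
    (hφ : chainForest a = LeafTree.node 1 L R :: C)
    (hX : IsLabeledForest N (LeafTree.node 1 L R :: C)) :
    phiChains k (delta cs k (Finsupp.single a 1)) =
      lowerLabels k (ofForest k [L] * antiMirror k R * ofForest k C) := by
  obtain ⟨J, K, b, s, rfl, hs, hb, hY, hsv⟩ := exists_tail_chain (A := []) ha hφ hX
  have hm := chainForest_chainAct_mirror cs hb hY (hX.remove_root (A := [])) (s := s)
    (by rw [hsv, value_map]; simp [forestSquash])
  rw [delta_single k cs hs, map_sub, phiChains_single, phiChains_single, hm, hY, antiMirror,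
    mul_sub, sub_mul, map_sub, ← ofForest_append, ← ofForest_append, ← ofForest_append,
    ← ofForest_append, lowerLabels_ofForest, lowerLabels_ofForest]
  simp [mirror_map]

/-- `δ` at a forest in which a tree other than the first has the root labeled `1`. -/
lemma phiChains_delta_later {N : ℕ} {a : List (Finset (Fin n))} (ha : IsSubsetChain a)
    {A C : List (LeafTree ℕ)} {L R : LeafTree ℕ} (hA : A ≠ [])
    (hφ : chainForest a = A ++ LeafTree.node 1 L R :: C)
    (hX : IsLabeledForest N (A ++ LeafTree.node 1 L R :: C)) :
    phiChains k (delta cs k (Finsupp.single a 1)) =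
      lowerLabels k (ofForest k A * (ofForest k [L, R] - ofForest k [R, L]) * ofForest k C) := by
  obtain ⟨J, K, b, s, rfl, hs, hb, hY, hsv⟩ := exists_tail_chain ha hφ hX
  have hYl := hX.remove_root
  rw [List.map_append, List.map_cons, List.map_cons] at hY hYl
  have hm := chainForest_chainAct_swap cs hb (by simpa using hA) hY hYl (s := s)
    (by rw [hsv, value_map]; simp [forestSquash, value_map, Function.comp_def])
  rw [delta_single k cs hs, map_sub, phiChains_single, phiChains_single, hm, hY,
    mul_sub, sub_mul, map_sub, ← ofForest_append, ← ofForest_append, ← ofForest_append,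
    ← ofForest_append, lowerLabels_ofForest, lowerLabels_ofForest]
  simp

/-! ### The operator Δ and Lie brackets -/

/-- The product of the first leaf of a tree and of the differences of the right subtrees along its
leftmost branch and their mirror images. -/
noncomputable def spine : LeafTree Unit → MonoidAlgebra k (FreeMonoid (LeafTree Unit))
  | leaf x => ofForest k [leaf x]
  | LeafTree.node _ l r => spine l * antiMirror k r

lemma map_erase_map (X : List (LeafTree ℕ)) (f : ℕ → ℕ) :
    (X.map (LeafTree.map f)).map erase = X.map erase := by
  rw [List.map_map]
  exact List.map_congr_left fun T _ => erase_map f T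

/-- Induction on the number of nodes, removing the node labeled 1. The right-hand side involves no
labels, so the order in which the nodes are removed has no influence. -/
lemma phiSubsets_Delta {N : ℕ} {a : List (Finset (Fin n))} (ha : IsSubsetChain a)
    {U : LeafTree ℕ} {V : List (LeafTree ℕ)} (hφ : chainForest a = U :: V)
    (hX : IsLabeledForest N (U :: V)) :
    phiSubsets k (Delta cs k (Finsupp.single a 1)) =
      liePi k (spine k U.erase * ofForest k (V.map erase)) := by
  induction h : forestLength (U :: V) generalizing a U V with
  | zero =>
    have h1 := (levels_chainForest ha).1
    rw [hφ, h, zero_add] at h1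
    obtain ⟨J, rfl⟩ := List.length_eq_one_iff.1 h1
    rw [Delta_single, List.length_singleton, Nat.sub_self, pow_zero, Module.End.one_apply,
      toSubsets, Finsupp.linearCombination_single, one_smul, phiSubsets,
      Finsupp.linearCombination_single, one_smul, ← liePi_ofForest_leaves]
    rw [chainForest] at hφ
    obtain ⟨x, c, hc, rfl, rfl⟩ := List.map_eq_cons_iff.1 hφ
    rw [hc, List.map_cons, ofForest_cons, List.map_map]
    rfl
  | succ l ih =>
    obtain ⟨A, L, R, C, hA⟩ := hX.exists_root_one (by omega)
    have hlen := forestLength_remove_root A C L R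
    rw [← hA, h] at hlen
    rw [hA] at hX hφ
    obtain ⟨J, K, b, s, rfl, hs, hb, hY, hsv⟩ := exists_tail_chain ha hφ hX
    have hYl := hX.remove_root
    rw [List.map_append, List.map_cons, List.map_cons] at hY hYl hlen
    have hact := isSubsetChain_chainAct cs hb s
    rw [Delta_single_cons k cs hs, map_sub]
    cases A with
    | nil =>
      obtain ⟨rfl, rfl⟩ := List.cons_eq_cons.1 hA
      rw [List.map_nil, List.nil_append] at hY hYl hlen
      have hm := chainForest_chainAct_mirror cs hb hY hYl (s := s)
        (by rw [hsv, value_map]; simp [forestSquash])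
      rw [ih hb hY hYl (by omega), ih hact hm (hYl.mirror (A := [_]))
        (by simp only [forestLength_cons, length_mirror] at hlen ⊢; omega), ← map_sub]
      simp only [List.map_cons, map_erase_map, erase_map, mirror_map]
      -- The terms differ only in R and its mirror image; their difference is the factor by which
      -- the spine of the node extends that of L.
      rw [ofForest_cons, ofForest_cons k (R.mirror.erase), ← mul_sub, ← sub_mul, mirror_erase,
        ← mul_assoc]
      rfl
    | cons U' A =>
      obtain ⟨rfl, rfl⟩ := List.cons_eq_cons.1 hA
      have hm := chainForest_chainAct_swap cs hb (by simp) hY hYl (s := s)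
        (by rw [hsv, value_map]; simp [forestSquash, value_map, Function.comp_def])
      rw [List.map_cons, List.cons_append] at hY hYl hm hlen
      have hperm : (map (· - 1) U :: (A.map (LeafTree.map (· - 1)) ++ L.map (· - 1) ::
          R.map (· - 1) :: C.map (LeafTree.map (· - 1)))).Perm
          (map (· - 1) U :: (A.map (LeafTree.map (· - 1)) ++ R.map (· - 1) ::
          L.map (· - 1) :: C.map (LeafTree.map (· - 1)))) :=
        ((List.Perm.swap _ _ _).append_left _).cons _
      rw [ih hb hY hYl (by omega), ih hact hm (hYl.perm hperm)
        (by rw [← show forestLength _ = forestLength _ from (hperm.map _).sum_eq]; omega)]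
      simp only [List.append_eq, List.map_cons, List.map_append, map_erase_map, erase_map]
      -- Both terms share the spine of the first tree, and exchanging L and R behind it gives the
      -- bracket of the removed node.
      rw [map_mul, map_mul, map_mul, ← mul_sub, liePi_ofForest_sub_swap]
      rfl

lemma spine_eq_prod (U : LeafTree ℕ) (m : ℕ)
    (hm : IsGreatest {i : ℕ | (U.subtree? (List.replicate i 1)).isSome} m) :
    spine k U.erase = ofForest k [(U.subtree (List.replicate m 1)).erase] *
      ((List.range m).reverse.map fun i =>
        antiMirror k (U.subtree (List.replicate i 1 ++ [2])).erase).prod := by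
  induction U generalizing m with
  | leaf x =>
    have : m = 0 := by
      have := hm.1
      cases m with
      | zero => rfl
      | succ m => simp [List.replicate_succ, subtree?] at this
    subst this
    simp [subtree, subtree?, spine, erase, map]
  | node a l r ihl _ =>
    obtain ⟨m, rfl⟩ : ∃ m', m = m' + 1 := by
      have : 1 ∈ {i : ℕ | ((LeafTree.node a l r).subtree? (List.replicate i 1)).isSome} := by
        simp [subtree?]
      have := hm.2 this
      exact ⟨m - 1, by omega⟩
    have hm' : IsGreatest {i : ℕ | (l.subtree? (List.replicate i 1)).isSome} m := by
      refine ⟨?_, fun i hi => ?_⟩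
      · simpa [List.replicate_succ, subtree?] using hm.1
      · have : i + 1 ∈ {i : ℕ | ((LeafTree.node a l r).subtree? (List.replicate i 1)).isSome} := by
          simpa [List.replicate_succ, subtree?] using hi
        have := hm.2 this
        omega
    have h1 := ihl m hm'
    -- The index 0, the right child of the root, gives the last factor; the other indices shift by
    -- one into the left child.
    rw [List.range_succ_eq_map, List.reverse_cons, List.map_append, List.prod_append,
      ← List.map_reverse, List.map_map, List.map_singleton, List.prod_singleton, ← mul_assoc]
    have h2 : spine k (LeafTree.node a l r).erase = spine k l.erase * antiMirror k r.erase := rfl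
    have h3 : ∀ w, (LeafTree.node a l r).subtree (1 :: w) = l.subtree w := fun w => by
      simp [subtree, subtree?]
    have h4 : (LeafTree.node a l r).subtree [2] = r := by simp [subtree, subtree?]
    rw [h2, h1]
    simp only [Function.comp_def, Nat.succ_eq_add_one, List.replicate_succ, List.cons_append, h3,
      List.replicate_zero, List.nil_append, h4]

/-- Each node contributes one sign, by antisymmetry of the bracket. -/
lemma lieTree_mirror (T : LeafTree Unit) :
    lieTree k T.mirror = (-1 : k) ^ T.length • lieTree k T := by
  induction T with
  | leaf x => simp [mirror, length]
  | node a l r hl hr =>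
    simp only [mirror, lieTree, hl, hr, length, smul_mul_smul_comm, pow_succ, pow_add]
    rw [mul_comm ((-1 : k) ^ r.length), ← smul_sub, mul_neg_one, neg_smul, ← smul_neg, neg_sub]

lemma liePi_antiMirror_of_odd {T : LeafTree Unit} (h : Odd T.length) :
    liePi k (antiMirror k T) = (2 : k) • liePi k (ofForest k [T]) := by
  rw [antiMirror, map_sub, liePi_ofForest_singleton, liePi_ofForest_singleton, lieTree_mirror,
    h.neg_one_pow, two_smul, neg_one_smul, sub_neg_eq_add]

lemma liePi_antiMirror_of_not_odd {T : LeafTree Unit} (h : ¬ Odd T.length) :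
    liePi k (antiMirror k T) = 0 := by
  rw [antiMirror, map_sub, liePi_ofForest_singleton, liePi_ofForest_singleton, lieTree_mirror,
    (Nat.not_odd_iff_even.1 h).neg_one_pow, one_smul, sub_self]

lemma liePi_prod_antiMirror {X : List (LeafTree Unit)} (h : ∀ T ∈ X, Odd T.length) :
    liePi k (X.map (antiMirror k)).prod = (2 : k) ^ X.length • liePi k (ofForest k X) := by
  induction X with
  | nil => simp [ofForest_nil]
  | cons T X ih =>
    rw [List.map_cons, List.prod_cons, map_mul, ih fun S hS => h S (by simp [hS]),
      liePi_antiMirror_of_odd k (h T (by simp)), smul_mul_smul_comm, ofForest_cons k T X, map_mul,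
      List.length_cons, pow_succ']

lemma liePi_prod_antiMirror_eq_zero {X : List (LeafTree Unit)} {T : LeafTree Unit} (hT : T ∈ X)
    (h : ¬ Odd T.length) : liePi k (X.map (antiMirror k)).prod = 0 := by
  rw [map_list_prod]
  exact List.prod_eq_zero (List.mem_map.2 ⟨_, List.mem_map_of_mem hT,
    liePi_antiMirror_of_not_odd k h⟩)

end Delta

lemma ofFn_eq_take_append {α : Type*} {j i : ℕ} (V : Fin j → α) (h : i + 1 < j) :
    List.ofFn V = (List.ofFn V).take i ++ V ⟨i, Nat.lt_of_succ_lt h⟩ :: V ⟨i + 1, h⟩ ::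
      (List.ofFn V).drop (i + 2) := by
  conv_lhs => rw [← List.take_append_drop i (List.ofFn V)]
  rw [List.drop_eq_getElem_cons (by simp; omega), List.drop_eq_getElem_cons (by simp; omega)]
  simp

end DescentB

theorem mainTheorem4 (k : Type*) [Field k] [CharZero k] {W : Type*} [Group W]
    (n : ℕ) (cs : CoxeterSystem (typeB n) W)
    (j : ℕ) (U : LeafTree ℕ) (V : Fin j → LeafTree ℕ)
    (hX : IsLabeledForest (n + 1) (U :: List.ofFn V))
    (J₀ : Finset (Fin n)) (a' : List (Finset (Fin n)))
    (ha : IsSubsetChain (J₀ :: a'))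
    (hφ : chainForest (J₀ :: a') = U :: List.ofFn V)
    (t : Fin j → Fin n) (ht : StrictMono t) (htJ : ∀ s, s ∈ Set.range t ↔ s ∉ J₀) :
    -- the action is well defined at this chain
    (∀ s : Fin n, IsSubsetChain (chainAct cs (J₀ :: a') s) ∧
      ∀ J ∈ J₀ :: a', cs.simple '' (conjSubset cs (omega cs J₀ s) J : Set (Fin n)) =
        (fun x => (omega cs J₀ s)⁻¹ * x * omega cs J₀ s) '' (cs.simple '' (J : Set (Fin n)))) ∧
    -- the generator `t₀` mirrors the first of the trees `V`
    (∀ h : 0 < j, chainForest (chainAct cs (J₀ :: a') (t ⟨0, h⟩)) =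
      U :: List.ofFn (Function.update V ⟨0, h⟩ (V ⟨0, h⟩).mirror)) ∧
    -- the generator `t_i` with `1 ≤ i ≤ j - 1` swaps the `i`-th and the `(i + 1)`-st
    (∀ (i : ℕ) (h : i + 1 < j), chainForest (chainAct cs (J₀ :: a') (t ⟨i + 1, h⟩)) =
      U :: List.ofFn (V ∘ Equiv.swap ⟨i, Nat.lt_of_succ_lt h⟩ ⟨i + 1, h⟩)) ∧
    -- `δ(X)` when the node labeled `1` is `U`
    (∀ U₁ U₂ : LeafTree ℕ, U = LeafTree.node 1 U₁ U₂ →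
      phiChains k (delta cs k (Finsupp.single (J₀ :: a') 1)) =
        lowerLabels k (ofForest k [U₁] * antiMirror k U₂ * ofForest k (List.ofFn V))) ∧
    -- `δ(X)` when the node labeled `1` is one of the trees `V`
    (∀ (i : Fin j) (A B : LeafTree ℕ), V i = LeafTree.node 1 A B →
      phiChains k (delta cs k (Finsupp.single (J₀ :: a') 1)) =
        lowerLabels k (ofForest k (U :: (List.ofFn V).take i) *
          (ofForest k [A, B] - ofForest k [B, A]) * ofForest k ((List.ofFn V).drop (i + 1)))) ∧
    -- the two formulas for `Δ(X)`
    (∀ m : ℕ, IsGreatest {i : ℕ | (U.subtree? (List.replicate i 1)).isSome} m →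
      phiSubsets k (Delta cs k (Finsupp.single (J₀ :: a') 1)) =
        liePi k (ofForest k [(U.subtree (List.replicate m 1)).erase] *
          ((List.range m).reverse.map fun i =>
            antiMirror k (U.subtree (List.replicate i 1 ++ [2])).erase).prod *
          ofForest k (List.ofFn fun i => (V i).erase)) ∧
      ((∀ i < m, Odd (U.subtree (List.replicate i 1 ++ [2])).length) →
        phiSubsets k (Delta cs k (Finsupp.single (J₀ :: a') 1)) =
          (2 : k) ^ m • liePi k (ofForest k ((U.subtree (List.replicate m 1)).erase ::
            ((List.range m).reverse.map fun i =>
              (U.subtree (List.replicate i 1 ++ [2])).erase) ++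
            List.ofFn fun i => (V i).erase))) ∧
      ((¬ ∀ i < m, Odd (U.subtree (List.replicate i 1 ++ [2])).length) →
        phiSubsets k (Delta cs k (Finsupp.single (J₀ :: a') 1)) = 0)) := by
  have hsq : U.value :: (List.ofFn V).map LeafTree.value = composition J₀ := by
    rw [← (levels_chainForest ha).2.2 J₀ a' rfl, hφ]
    rfl
  have hlen : (composition J₀).length = j + 1 := by rw [← hsq]; simp
  -- Hence t_i + 1 is the sum of the values of U and of the first i trees of V, which is the
  -- position required of the generator in the mirror and exchange lemmas.
  have ht' := enum_compl_add_one ht htJ hlen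
  rw [← hsq] at ht'
  refine ⟨fun s => ⟨isSubsetChain_chainAct cs ha s, fun J hJ =>
    simple_image_conjSubset cs (ha.subset hJ) s⟩, fun h => ?_, fun i h => ?_, ?_, ?_, ?_⟩
  · obtain ⟨j, rfl⟩ : ∃ i, j = i + 1 := ⟨j - 1, by omega⟩
    rw [List.ofFn_succ] at hφ hX
    have h0 : (⟨0, h⟩ : Fin (j + 1)) = 0 := rfl
    rw [chainForest_chainAct_mirror cs ha hφ hX (by simpa using ht' ⟨0, h⟩), List.ofFn_succ, h0]
    simp
  · have hV := ofFn_eq_take_append V h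
    -- The trees are indexed from 0 here, so the generator with index i + 1 exchanges those with
    -- indices i and i + 1.
    have hV' : List.ofFn (V ∘ Equiv.swap ⟨i, Nat.lt_of_succ_lt h⟩ ⟨i + 1, h⟩) =
        (List.ofFn V).take i ++ V ⟨i + 1, h⟩ :: V ⟨i, by omega⟩ :: (List.ofFn V).drop (i + 2) := by
      rw [ofFn_eq_take_append _ h]
      congr 1
      · refine List.ext_getElem (by simp) fun l h₁ h₂ => ?_
        simp only [List.length_take, List.length_ofFn] at h₁
        simp only [List.getElem_take, List.getElem_ofFn, Function.comp_apply]
        rw [Equiv.swap_apply_of_ne_of_ne] <;> simp only [ne_eq, Fin.mk.injEq] <;> omega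
      · rw [Function.comp_apply, Function.comp_apply, Equiv.swap_apply_left,
          Equiv.swap_apply_right]
        congr 2
        refine List.ext_getElem (by simp) fun l h₁ h₂ => ?_
        simp only [List.getElem_drop, List.getElem_ofFn, Function.comp_apply]
        rw [Equiv.swap_apply_of_ne_of_ne] <;> simp only [ne_eq, Fin.mk.injEq] <;> omega
    have hs := ht' ⟨i + 1, h⟩
    rw [hV] at hφ hX
    rw [hV', ← List.cons_append]
    refine chainForest_chainAct_swap cs ha (by simp) hφ hX ?_
    rw [hs, List.take_succ_cons, List.sum_cons, ← List.map_take, List.take_add_one]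
    simp [forestSquash, Nat.add_assoc, Nat.lt_of_succ_lt h]
  · rintro U₁ U₂ rfl
    exact phiChains_delta_first k cs ha hφ hX
  · intro i A B hi
    have hV : List.ofFn V = (List.ofFn V).take i ++ V i :: (List.ofFn V).drop (i + 1) := by
      conv_lhs => rw [← List.take_append_drop i (List.ofFn V)]
      rw [List.drop_eq_getElem_cons (by simp)]
      simp
    rw [hi] at hV
    refine phiChains_delta_later k cs (N := n + 1) ha (A := U :: (List.ofFn V).take i) (by simp) ?_ ?_
    · rw [List.cons_append, ← hV, hφ]
    · rw [List.cons_append, ← hV]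
      exact hX
  · intro m hm
    have hE : (List.ofFn V).map LeafTree.erase = List.ofFn fun i => (V i).erase := by
      rw [List.map_ofFn]; rfl
    have h1 := phiSubsets_Delta k cs ha hφ hX
    rw [hE, spine_eq_prod k U m hm] at h1
    set X := (List.range m).reverse.map fun i =>
      (U.subtree (List.replicate i 1 ++ [2])).erase with hXdef
    have hprod : ((List.range m).reverse.map fun i =>
        antiMirror k (U.subtree (List.replicate i 1 ++ [2])).erase) = X.map (antiMirror k) := by
      rw [hXdef, List.map_map]; rfl
    refine ⟨h1, fun hodd => ?_, fun hodd => ?_⟩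
    · have hX' : ∀ T ∈ X, Odd T.length := by
        intro T hT
        obtain ⟨i, hi, rfl⟩ := List.mem_map.1 hT
        rw [LeafTree.erase, LeafTree.length_map]
        exact hodd i (by simpa using hi)
      rw [h1, hprod, map_mul, map_mul, liePi_prod_antiMirror k hX', mul_smul_comm, smul_mul_assoc,
        ← map_mul, ← map_mul, ← ofForest_append, ← ofForest_append]
      simp [hXdef]
    · push Not at hodd
      obtain ⟨i, hi, hodd⟩ := hodd
      rw [h1, hprod, map_mul, map_mul, liePi_prod_antiMirror_eq_zero k
        (T := (U.subtree (List.replicate i 1 ++ [2])).erase)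
        (List.mem_map.2 ⟨i, by simpa using hi, rfl⟩)
        (by rw [LeafTree.erase, LeafTree.length_map]; exact hodd), mul_zero, zero_mul]
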